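/- Let $\mathcal A$ be an $n$-dimensional Frobenius algebra over $\mathbb R$: a commutative associative unital real algebra with a linear functional $\mathrm{tr}:\mathcal A\to\mathbb R$ such that $\langle a,b\rangle=\mathrm{tr}(a\circ b)$ is non-degenerate. Fix a basis $e_1,\dots,e_n$ of $\mathcal A$ and an integer $m\ge 1$. **Setting.** Let $\mathfrak D$ be the algebra of real polynomials in symbols $v_{[i]q}^{(j)}$ ($i\le m-1$ an integer, $1\le q\le n$, $j\ge0$), with the derivation $\partial v_{[i]q}^{(j)}=v_{[i]q}^{(j+1)}$, and write $v_{[i]q}=v_{[i]q}^{(0)}$. Extend $\partial$ and $\mathrm{tr}$ to $\mathcal A\otimes\mathfrak D$ coefficientwise, and let $\int f\,dx$ denote the class of $f$ in $\mathfrak D/\partial\mathfrak D$. Put $V_i=\sum_q v_{[i]q}e_q$ and $$\mathcal L=\partial^m+V_{m-1}\partial^{m-1}+V_{m-2}\partial^{m-2}+\cdots,$$ a pseudo-differential operator over $\mathcal A\otimes\mathfrak D$. For $P=\sum_i P_i\partial^i$ let $P_+=\sum_{i\ge0}P_i\partial^i$, $P_-=P-P_+$, $\mathrm{res}\,P=P_{-1}$.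 Let $S$ be either all of $\mathcal A\otimes\mathfrak D$ or the algebra of $\mathcal A$-valued differential polynomials in the $V_i$ (generated over $\mathcal A$ by all $\partial^jV_i$). Let $\mathcal V$ be the Lie algebra of vector fields $\partial_{\mathbf a}=\sum_{i,j,q}(\partial^ja_{[i]q})\,\partial/\partial v_{[i]q}^{(j)}$, where $\mathbf a=\sum_{i\le m-1}a_i\partial^i$, $a_i=\sum_q a_{[i]q}e_q$; it acts on $\mathfrak D$ and on $\mathfrak D/\partial\mathfrak D$. Let $\Omega^1$ be the space of finite sums $X=\sum_{i\le m-1}\partial^{-i-1}X_i$ with $X_i\in S$, paired with $\mathcal V$ by $\langle\partial_{\mathbf a},X\rangle=\mathrm{tr}\int\mathrm{res}(\mathbf a\circ X)\,dx$. A linear mapping $\mathcal H:\Omega^1\to\mathcal V$, $\mathcal H(X)=\partial_{H(X)}$, where $H(X)$ has order at most $m-1$ and coefficients in $S$, is *Hamiltonian* if it is skew, $\langle\mathcal H(X),Y\rangle=-\langle\mathcal H(Y),X\rangle$; its image $\mathcal H\Omega^1$ is a Lie subalgebra of $\mathcal V$; and the 2-form on $\mathcal H\Omega^1$ given by $\omega(\mathcal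 H(X),\mathcal H(Y))=\langle\mathcal H(X),Y\rangle$ is well defined and closed. Functionals are the classes $\tilde f=\int f\,dx$ with $f=\mathrm{tr}\,F$, $F\in S$. Define $\frac{\delta f}{\delta V_i}$ by $\mathrm{tr}\big(\frac{\delta f}{\delta V_i}\circ e_q\big)=\sum_j(-\partial)^j\frac{\partial f}{\partial v_{[i]q}^{(j)}}$ for all $q$, and $\frac{\delta f}{\delta\mathcal L}=\sum_{i\le m-1}\partial^{-i-1}\frac{\delta f}{\delta V_i}$. **Lemma 3.4.** (1) For every $z\in\mathbb R$, with $\widetilde{\mathcal L}=\mathcal L-z$ and $$A^{(z)}(X)=(\widetilde{\mathcal L}\circ X)_+\circ\widetilde{\mathcal L}-\widetilde{\mathcal L}\circ(X\circ\widetilde{\mathcal L})_+,$$ the mapping $X\mapsto\partial_{A^{(z)}(X)}$ is Hamiltonian. (2) $A^{(z)}(X)=H^{m(0)}(X)+z\,H^{m(\infty)}(X)$, where $$H^{m(0)}(X)=(\mathcal L\circ X)_+\circ\mathcal L-\mathcal L\circ(X\circ\mathcal L)_+,\qquad H^{m(\infty)}(X)=[\mathcal L_-,X_+]_--[\mathcal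 L_+,X_-]_+,$$ and both $X\mapsto\partial_{H^{m(0)}(X)}$ and $X\mapsto\partial_{H^{m(\infty)}(X)}$ are Hamiltonian. (3) For every $f=\mathrm{tr}\,F$ with $F\in S$ one has $\frac{\delta f}{\delta\mathcal L}\in\Omega^1$, and for $\bullet\in\{0,\infty\}$ the formula $$\{\tilde f,\tilde g\}^{m(\bullet)}=\mathrm{tr}\int\mathrm{res}\;H^{m(\bullet)}\Big(\frac{\delta f}{\delta\mathcal L}\Big)\circ\frac{\delta g}{\delta\mathcal L}\,dx$$ gives a well-defined bilinear bracket on the space of functionals which is skew, satisfies the Jacobi identity, and is local: $\{\tilde f,\tilde g\}^{m(\bullet)}=\mathrm{tr}\int\sum_{i,j}P_{ij}\big(\frac{\delta f}{\delta V_j}\big)\circ\frac{\delta g}{\delta V_i}\,dx$ with differential operators $P_{ij}$ of finite order with coefficients in $S$. The two brackets are compatible: every real linear combination $a\{\,,\}^{m(0)}+b\{\,,\}^{m(\infty)}$ is again a Poisson bracket. -/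

import Mathlib

namespace FrobKP

open MvPolynomial

/-- A trace form (Frobenius form) on a commutative real algebra `A`: a linear functional for which
`⟨a, b⟩ = form (a * b)` is non-degenerate. -/
structure TraceForm (A : Type*) [CommRing A] [Algebra ℝ A] where
  form : A →ₗ[ℝ] ℝ
  nondeg : ∀ a : A, (∀ b : A, form (a * b) = 0) → a = 0

/-- The inner product `⟨a, b⟩ = form (a * b)`. -/
noncomputable def TraceForm.bilin {A : Type*} [CommRing A] [Algebra ℝ A] (tr : TraceForm A) :
    LinearMap.BilinForm ℝ A :=
  (LinearMap.mul ℝ A).compr₂ tr.form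

theorem TraceForm.bilin_nondegenerate {A : Type*} [CommRing A] [Algebra ℝ A] (tr : TraceForm A) :
    tr.bilin.Nondegenerate :=
  ⟨fun a h => tr.nondeg a h,
   fun a h => tr.nondeg a fun b => by simpa [TraceForm.bilin, mul_comm] using h b⟩

/-! ### Pseudo-differential operators over a commutative differential algebra -/

/-- Formal series `∑ i ≤ N, P i ∂ⁱ` (coefficients on the left), given by the coefficient
function. -/
def psiDOs (R : Type*) [CommRing R] [Algebra ℝ R] : Submodule ℝ (ℤ → R) where
  carrier := {P | ∃ N : ℤ, ∀ i, N < i → P i = 0}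
  zero_mem' := ⟨0, fun _ _ => rfl⟩
  add_mem' := by
    rintro P Q ⟨M, hM⟩ ⟨N, hN⟩
    refine ⟨max M N, fun i hi => ?_⟩
    simp [hM i (lt_of_le_of_lt (le_max_left _ _) hi), hN i (lt_of_le_of_lt (le_max_right _ _) hi)]
  smul_mem' := by
    rintro c P ⟨M, hM⟩
    exact ⟨M, fun i hi => by simp [hM i hi]⟩

/-- Pseudo-differential operators with coefficients in `R`. -/
abbrev PsiDO (R : Type*) [CommRing R] [Algebra ℝ R] : Type _ := psiDOs R

namespace PsiDO

variable {R : Type*} [CommRing R] [Algebra ℝ R]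

/-- The coefficient of `∂ⁱ`. -/
def coeff (P : PsiDO R) (i : ℤ) : R := P.1 i

/-- Composition, from `(a ∂ⁱ) ∘ (b ∂ʲ) = ∑ k ≥ 0, (i choose k) a (Dᵏ b) ∂ⁱ⁺ʲ⁻ᵏ`. The coefficient of
`∂ˡ` collects the pairs `(i, k)`, with `j = l + k - i`; only finitely many of them contribute. -/
noncomputable def mul (D : R → R) (hD : D 0 = 0) (P Q : PsiDO R) : PsiDO R :=
  ⟨fun l => ∑ᶠ p : ℤ × ℕ,
      Ring.choose p.1 p.2 • (P.coeff p.1 * D^[p.2] (Q.coeff (l + p.2 - p.1))), by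
    obtain ⟨M, hM⟩ := P.2
    obtain ⟨N, hN⟩ := Q.2
    refine ⟨M + N, fun l hl => ?_⟩
    have hz : ∀ k : ℕ, D^[k] 0 = 0 := fun k => Function.iterate_fixed hD k
    have h0 : ∀ p : ℤ × ℕ, Ring.choose p.1 p.2 •
        (P.coeff p.1 * D^[p.2] (Q.coeff (l + p.2 - p.1))) = 0 := by
      intro p
      by_cases hp : M < p.1
      · simp [coeff, hM _ hp]
      · have : N < l + p.2 - p.1 := by omega
        simp [coeff, hN _ this, hz]
    simp [h0]⟩

/-- The monomial `a ∂ⁱ`. -/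
def single (i : ℤ) (a : R) : PsiDO R :=
  ⟨Pi.single i a, i, fun j hj => by simp [hj.ne']⟩

/-- The pure differential part. -/
def pos (P : PsiDO R) : PsiDO R :=
  ⟨fun i => if 0 ≤ i then P.coeff i else 0, by
    obtain ⟨M, hM⟩ := P.2
    exact ⟨M, fun i hi => by simp [coeff, hM i hi]⟩⟩

/-- `P₋ = P - P₊`. -/
def neg (P : PsiDO R) : PsiDO R := P - P.pos

/-- The residue: the coefficient of `∂⁻¹`. -/
def res (P : PsiDO R) : R := P.coeff (-1)

end PsiDO

/-! ### Differential polynomials -/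

/-- The indices `i = m-1, m-2, …` of the fields `V i`. -/
abbrev Idx (m : ℕ) : Type := {i : ℤ // i < m}

/-- The symbols `v_{[i]q}^{(j)}`, encoded as `(i, q, j)`. -/
abbrev Jet (m n : ℕ) : Type := Idx m × Fin n × ℕ

/-- Differential polynomials in the symbols `v_{[i]q}` with coefficients in `B`. For `B = ℝ` this is
the differential algebra `𝔇`, for `B = A` its `A`-valued version. -/
abbrev DPoly (m n : ℕ) (B : Type*) [CommRing B] : Type _ := MvPolynomial (Jet m n) B

section Poly

variable {m n : ℕ}

/-- The derivation `∂ = d/dx`, with `∂ v_{[i]q}^{(j)} = v_{[i]q}^{(j+1)}`. -/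
noncomputable def dx (B : Type*) [CommRing B] : Derivation B (DPoly m n B) (DPoly m n B) :=
  mkDerivation B fun p => X (p.1, p.2.1, p.2.2 + 1)

/-- Functionals `∫ f dx`: differential polynomials modulo total derivatives. -/
abbrev Functional (m n : ℕ) : Type :=
  DPoly m n ℝ ⧸ LinearMap.range (dx (m := m) (n := n) ℝ).toLinearMap

/-- `f ↦ ∫ f dx`. -/
noncomputable def integral : DPoly m n ℝ →ₗ[ℝ] Functional m n := Submodule.mkQ _

variable {A : Type*} [CommRing A] [Algebra ℝ A]

/-- The coefficientwise application of a linear functional `A → ℝ`; on `A`-valued differential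
polynomials, the trace form acts in this way. -/
noncomputable def mapCoeff (φ : A →ₗ[ℝ] ℝ) : DPoly m n A →ₗ[ℝ] DPoly m n ℝ where
  toFun p := AddMonoidAlgebra.map φ.toAddMonoidHom p
  map_add' p q := by
    ext t
    exact map_add φ (coeff t p) (coeff t q)
  map_smul' c p := by
    ext t
    exact map_smul φ c (coeff t p)

theorem coeff_mapCoeff (φ : A →ₗ[ℝ] ℝ) (p : DPoly m n A) (t : Jet m n →₀ ℕ) :
    coeff t (mapCoeff φ p) = φ (coeff t p) := rfl

/-- The real differential polynomial `f` times the algebra element `a`. -/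
noncomputable def tensor (f : DPoly m n ℝ) (a : A) : DPoly m n A :=
  C a * MvPolynomial.map (algebraMap ℝ A) f

/-! ### Vector fields -/

variable (m n) in
/-- The Lie algebra `𝒱` of derivations of `𝔇` commuting with `∂`. By `evol_char` below its elements
are exactly the fields `∂_a`. -/
noncomputable def vectorFields : LieSubalgebra ℝ (Derivation ℝ (DPoly m n ℝ) (DPoly m n ℝ)) where
  carrier := {D | ∀ f, D (dx ℝ f) = dx ℝ (D f)}
  zero_mem' := by simp
  add_mem' := by intro a b ha hb f; simp [ha f, hb f]
  smul_mem' := by intro c a ha f; simp [ha f]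
  lie_mem' := by
    intro a b ha hb f
    have ha' : ∀ f, a (dx ℝ f) = dx ℝ (a f) := ha
    have hb' : ∀ f, b (dx ℝ f) = dx ℝ (b f) := hb
    simp [Derivation.commutator_apply, ha', hb']

/-- The elements of `𝒱`. -/
abbrev VectorField (m n : ℕ) : Type := vectorFields m n

/-- The action of `𝒱` on functionals, `D (∫ f dx) = ∫ (D f) dx`. -/
noncomputable def VectorField.act (D : VectorField m n) : Functional m n →ₗ[ℝ] Functional m n :=
  Submodule.mapQ _ _ D.1.toLinearMap (by
    rintro _ ⟨f, rfl⟩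
    exact ⟨D.1 f, (D.2 f).symm⟩)

/-- The field `∂_a = ∑ a_{[i]q}^{(j)} ∂/∂v_{[i]q}^{(j)}`, where `a i = ∑ q, a_{[i]q} e_q`. -/
noncomputable def evol (e : Module.Basis (Fin n) ℝ A) (a : Idx m → DPoly m n A) :
    VectorField m n :=
  ⟨mkDerivation ℝ fun p => (dx ℝ)^[p.2.2] (mapCoeff (e.coord p.2.1) (a p.1)), by
    intro f
    set D : Derivation ℝ (DPoly m n ℝ) (DPoly m n ℝ) :=
      mkDerivation ℝ fun p => (dx ℝ)^[p.2.2] (mapCoeff (e.coord p.2.1) (a p.1)) with hD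
    have h : ⁅D, dx (m := m) (n := n) ℝ⁆ = 0 := by
      apply MvPolynomial.derivation_ext
      intro p
      simp [Derivation.commutator_apply, hD, dx, mkDerivation_X, Function.iterate_succ_apply']
    have h2 := congrArg (fun d : Derivation ℝ (DPoly m n ℝ) (DPoly m n ℝ) => d f) h
    simpa [Derivation.commutator_apply, sub_eq_zero] using h2⟩

/-- The sequence `a` of a field `D = ∂_a`, namely `a i = ∑ q, D(v_{[i]q}) e_q`. -/
noncomputable def VectorField.char (e : Module.Basis (Fin n) ℝ A) (D : VectorField m n) :
    Idx m → DPoly m n A :=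
  fun i => ∑ q, tensor (D.1 (X (i, q, 0))) (e q)

theorem mapCoeff_tensor (φ : A →ₗ[ℝ] ℝ) (f : DPoly m n ℝ) (a : A) :
    mapCoeff φ (tensor f a) = φ a • f := by
  ext t
  rw [coeff_mapCoeff, tensor, coeff_C_mul, coeff_map, coeff_smul, mul_comm, ← Algebra.smul_def,
    map_smul, smul_eq_mul, smul_eq_mul, mul_comm]

theorem evol_char (e : Module.Basis (Fin n) ℝ A) (D : VectorField m n) :
    evol e (D.char e) = D := by
  have hc : ∀ (i : Idx m) (q : Fin n),
      mapCoeff (e.coord q) (D.char e i) = D.1 (X (i, q, 0)) := by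
    intro i q
    simp [VectorField.char, map_sum, mapCoeff_tensor, Finsupp.single_apply]
  apply Subtype.ext
  apply MvPolynomial.derivation_ext
  rintro ⟨i, q, j⟩
  simp only [evol, mkDerivation_X, hc]
  induction j with
  | zero => rfl
  | succ j ih =>
    rw [Function.iterate_succ_apply', ih, ← D.2]
    simp [dx, mkDerivation_X]

/-! ### The Lax operator and the one-forms -/

/-- The field `V i = ∑ q, v_{[i]q} e_q`. -/
noncomputable def fieldV (e : Module.Basis (Fin n) ℝ A) (i : Idx m) : DPoly m n A :=
  ∑ q, C (e q) * X (i, q, 0)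

/-- The algebra of `A`-valued differential polynomials in the fields `V i`. -/
noncomputable def diffPolyV (m : ℕ) (e : Module.Basis (Fin n) ℝ A) : Subalgebra A (DPoly m n A) :=
  Algebra.adjoin A {F | ∃ (i : Idx m) (j : ℕ), F = (dx A)^[j] (fieldV e i)}

/-- Composition of pseudo-differential operators with differential polynomial coefficients. -/
noncomputable def comp (P Q : PsiDO (DPoly m n A)) : PsiDO (DPoly m n A) :=
  PsiDO.mul (dx A) (map_zero _) P Q

/-- The commutator `[P, Q]`. -/
noncomputable def comm (P Q : PsiDO (DPoly m n A)) : PsiDO (DPoly m n A) :=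
  comp P Q - comp Q P

/-- The operator `𝓛 = ∂ᵐ + V_{m-1} ∂ᵐ⁻¹ + V_{m-2} ∂ᵐ⁻² + ⋯`. -/
noncomputable def lax (m : ℕ) (e : Module.Basis (Fin n) ℝ A) : PsiDO (DPoly m n A) :=
  ⟨fun i => if h : i < m then fieldV e ⟨i, h⟩ else if i = m then 1 else 0, m, fun i hi => by
    simp only [dif_neg (not_lt.mpr hi.le), if_neg hi.ne']⟩

/-- The one-forms `X = ∑ i ≤ m-1, ∂⁻ⁱ⁻¹ X i` (finite sums), given by `i ↦ X i`. -/
abbrev OneForm (m n : ℕ) (A : Type*) [CommRing A] : Type _ := Idx m →₀ DPoly m n A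

/-- The pseudo-differential operator `∑ i, ∂⁻ⁱ⁻¹ ∘ X i`. -/
noncomputable def OneForm.toPsiDO (X : OneForm m n A) : PsiDO (DPoly m n A) :=
  X.sum fun i x => comp (PsiDO.single (-i.1 - 1) 1) (PsiDO.single 0 x)

/-- The one-forms with coefficients in the class `S`. -/
def Omega (S : Subalgebra A (DPoly m n A)) : Submodule ℝ (OneForm m n A) where
  carrier := {X | ∀ i, X i ∈ S}
  zero_mem' := fun _ => S.zero_mem
  add_mem' := fun ha hb i => S.add_mem (ha i) (hb i)
  smul_mem' := fun c X hX i => by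
    have h : (c • X) i = algebraMap ℝ A c • X i := by
      rw [Finsupp.smul_apply, algebraMap_smul]
    rw [h]
    exact S.smul_mem (hX i) _

/-- `tr ∫ res P dx`. -/
noncomputable def trIntRes (tr : TraceForm A) (P : PsiDO (DPoly m n A)) : Functional m n :=
  integral (mapCoeff tr.form P.res)

/-- The operator `∑ i ≤ m-1, a i ∂ⁱ`. -/
noncomputable def seqToPsiDO (a : Idx m → DPoly m n A) : PsiDO (DPoly m n A) :=
  ⟨fun i => if h : i < m then a ⟨i, h⟩ else 0, m, fun i hi => by
    simp only [dif_neg (not_lt.mpr hi.le)]⟩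

/-- The pairing `⟨∂_a, X⟩ = tr ∫ res (a ∘ X) dx`. -/
noncomputable def pairing (tr : TraceForm A) (e : Module.Basis (Fin n) ℝ A)
    (D : VectorField m n) (X : OneForm m n A) : Functional m n :=
  trIntRes tr (comp (seqToPsiDO (D.char e)) X.toPsiDO)

/-- The field `∂_P` attached to an operator `P` of order at most `m - 1`. -/
noncomputable def fieldOf (e : Module.Basis (Fin n) ℝ A) (P : PsiDO (DPoly m n A)) :
    VectorField m n :=
  evol e fun i => P.coeff i.1

/-! ### The Adler-type mappings -/

/-- `A^{(z)}(X) = (𝓛̃ X)₊ 𝓛̃ - 𝓛̃ (X 𝓛̃)₊` with `𝓛̃ = 𝓛 - z`. -/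
noncomputable def adler (e : Module.Basis (Fin n) ℝ A) (z : ℝ) (X : OneForm m n A) :
    PsiDO (DPoly m n A) :=
  let Lz := lax m e - z • PsiDO.single 0 1
  comp (comp Lz X.toPsiDO).pos Lz - comp Lz (comp X.toPsiDO Lz).pos

/-- `H^{m(0)}(X) = (𝓛 X)₊ 𝓛 - 𝓛 (X 𝓛)₊`. -/
noncomputable def hamZero (e : Module.Basis (Fin n) ℝ A) (X : OneForm m n A) :
    PsiDO (DPoly m n A) :=
  comp (comp (lax m e) X.toPsiDO).pos (lax m e) - comp (lax m e) (comp X.toPsiDO (lax m e)).pos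

/-- `H^{m(∞)}(X) = [𝓛₋, X₊]₋ - [𝓛₊, X₋]₊`. -/
noncomputable def hamInf (e : Module.Basis (Fin n) ℝ A) (X : OneForm m n A) :
    PsiDO (DPoly m n A) :=
  (comm (lax m e).neg X.toPsiDO.pos).neg - (comm (lax m e).pos X.toPsiDO.neg).pos

/-! ### Hamiltonian mappings -/

/-- A mapping from one-forms to operators gives a Hamiltonian mapping `X ↦ ∂_{H X}` (with
coefficients in the class `S`): `H X` has order at most `m - 1` and coefficients in `S`; the mapping
is linear and skew; its image is a Lie subalgebra `𝔥` of `𝒱`; and the 2-form `ω` on `𝔥` given by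
`ω(∂_{H X}, ∂_{H Y}) = ⟨∂_{H X}, Y⟩` is (well defined and) closed. -/
structure IsHamiltonianMap (tr : TraceForm A) (e : Module.Basis (Fin n) ℝ A)
    (S : Subalgebra A (DPoly m n A)) (H : OneForm m n A → PsiDO (DPoly m n A)) : Prop where
  order_lt : ∀ X ∈ Omega S, ∀ i : ℤ, (m : ℤ) ≤ i → (H X).coeff i = 0
  coeff_mem : ∀ X ∈ Omega S, ∀ i : ℤ, (H X).coeff i ∈ S
  linear : IsLinearMap ℝ fun X : Omega S => fieldOf e (H X.1)
  skew : ∀ X ∈ Omega S, ∀ Y ∈ Omega S,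
    pairing tr e (fieldOf e (H X)) Y = -pairing tr e (fieldOf e (H Y)) X
  closed : ∃ 𝔥 : LieSubalgebra ℝ (VectorField m n),
    (𝔥 : Set (VectorField m n)) = Set.range (fun X : Omega S => fieldOf e (H X.1)) ∧
    ∃ ω : 𝔥 →ₗ[ℝ] 𝔥 →ₗ[ℝ] Functional m n,
      (∀ X ∈ Omega S, ∀ Y ∈ Omega S, ∀ a b : 𝔥, (a : VectorField m n) = fieldOf e (H X) →
        (b : VectorField m n) = fieldOf e (H Y) → ω a b = pairing tr e (fieldOf e (H X)) Y) ∧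
      ∀ a b c : 𝔥,
        a.1.act (ω b c) + b.1.act (ω c a) + c.1.act (ω a b)
          - ω ⁅a, b⁆ c - ω ⁅b, c⁆ a - ω ⁅c, a⁆ b = 0

/-! ### Functionals, variational derivatives and brackets -/

/-- `F ↦ ∫ tr F dx` for `F` in the class `S`. -/
noncomputable def toFunctional (tr : TraceForm A) (S : Subalgebra A (DPoly m n A)) :
    S →ₗ[ℝ] Functional m n :=
  (integral ∘ₗ mapCoeff tr.form) ∘ₗ (S.val.restrictScalars ℝ).toLinearMap

/-- The space of functionals `∫ tr F dx` with `F` in the class `S`. -/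
noncomputable abbrev FunctionalSpace (tr : TraceForm A) (S : Subalgebra A (DPoly m n A)) :
    Submodule ℝ (Functional m n) :=
  LinearMap.range (toFunctional tr S)

/-- `δf/δv_{[i]q} = ∑ j, (-∂)ʲ ∂f/∂v_{[i]q}^{(j)}` (a finite sum). -/
noncomputable def varDeriv (f : DPoly m n ℝ) (i : Idx m) (q : Fin n) : DPoly m n ℝ :=
  ∑ᶠ j : ℕ, (-1 : ℝ) ^ j • (dx ℝ)^[j] (pderiv (i, q, j) f)

/-- `δf/δV i`, the element with `tr (δf/δV i * δV) = ∑ q, (δf/δv_{[i]q}) δv_q` for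
`δV = ∑ q, δv_q e_q`, written in the basis dual to `e` for the trace form. -/
noncomputable def varDerivV (tr : TraceForm A) (e : Module.Basis (Fin n) ℝ A) (f : DPoly m n ℝ)
    (i : Idx m) : DPoly m n A :=
  ∑ q, tensor (varDeriv f i q) (tr.bilin.dualBasis tr.bilin_nondegenerate e q)

/-- `δf/δ𝓛 = ∑ i, ∂⁻ⁱ⁻¹ δf/δV i`. -/
noncomputable def varDerivL (tr : TraceForm A) (e : Module.Basis (Fin n) ℝ A) (f : DPoly m n ℝ) :
    OneForm m n A :=
  Finsupp.onFinset (f.vars.image Prod.fst) (varDerivV tr e f) (by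
    intro i hi
    by_contra hmem
    apply hi
    have h : ∀ q, varDeriv f i q = 0 := by
      intro q
      have h0 : ∀ j : ℕ, (-1 : ℝ) ^ j • (dx ℝ)^[j] (pderiv (i, q, j) f) = 0 := by
        intro j
        have hv : (i, q, j) ∉ f.vars := fun hv => hmem (Finset.mem_image_of_mem _ hv)
        rw [pderiv_eq_zero_of_notMem_vars hv, Function.iterate_fixed (map_zero (dx ℝ)), smul_zero]
      simp [varDeriv, h0]
    simp [varDerivV, h, tensor])

/-- The bracket `tr ∫ res (H(δf/δ𝓛) ∘ δg/δ𝓛) dx` attached to a mapping `H`. -/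
noncomputable def bracket (tr : TraceForm A) (e : Module.Basis (Fin n) ℝ A)
    (H : OneForm m n A → PsiDO (DPoly m n A)) (f g : DPoly m n ℝ) : Functional m n :=
  trIntRes tr (comp (H (varDerivL tr e f)) (varDerivL tr e g).toPsiDO)

/-- An expression `β f g` in densities `f`, `g` descends to a Poisson bracket on the space of
functionals `∫ tr F dx`, `F` in the class `S`: a bilinear skew bracket on that space which satisfies
the Jacobi identity. -/
def IsPoissonBracket (tr : TraceForm A) (S : Subalgebra A (DPoly m n A))
    (β : DPoly m n ℝ → DPoly m n ℝ → Functional m n) : Prop :=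
  ∃ B : FunctionalSpace tr S →ₗ[ℝ] FunctionalSpace tr S →ₗ[ℝ] FunctionalSpace tr S,
    (∀ F G : S, (B ((toFunctional tr S).rangeRestrict F) ((toFunctional tr S).rangeRestrict G) :
      Functional m n) = β (mapCoeff tr.form F.1) (mapCoeff tr.form G.1)) ∧
    (∀ x y, B x y = -B y x) ∧
    ∀ x y z, B x (B y z) + B y (B z x) + B z (B x y) = 0

/-- Locality: `β f g = tr ∫ ∑ i j, (P i j (δf/δV j)) (δg/δV i) dx`, where each
`P i j = ∑ k, p k ∂ᵏ` is a differential operator of finite order with coefficients in `S`. -/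
def IsLocalBracket (tr : TraceForm A) (e : Module.Basis (Fin n) ℝ A)
    (S : Subalgebra A (DPoly m n A))
    (β : DPoly m n ℝ → DPoly m n ℝ → Functional m n) : Prop :=
  ∃ P : Idx m → Idx m → ℕ →₀ DPoly m n A,
    (∀ i j k, P i j k ∈ S) ∧
    ∀ F ∈ S, ∀ G ∈ S, β (mapCoeff tr.form F) (mapCoeff tr.form G) =
      (varDerivL tr e (mapCoeff tr.form F)).sum fun j x =>
        (varDerivL tr e (mapCoeff tr.form G)).sum fun i y =>
          integral (mapCoeff tr.form (((P i j).sum fun k p => p * (dx A)^[k] x) * y))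

end Poly

end FrobKP

namespace FrobKP

open MvPolynomial Finset

/-! ### Coefficients of pseudo-differential operators -/

namespace PsiDO

variable {R : Type*} [CommRing R] [Algebra ℝ R]

/-! Almost all of the statement is algebra in a ring with a splitting and a trace.
Pseudo-differential operators form an associative ring (`mul_assoc'`) in which differential
operators and operators of negative order are complementary subrings, so the projection `pos`
satisfies a Rota–Baxter identity (`IsSplitting.rotaBaxter`). The functional τ = tr ∫ res is cyclic
because the residue of a commutator is a total derivative (`res_comm_mem_range`), and both subrings
are isotropic for τ (`isSplitTrace`). These facts alone give three identities, for the Adler map and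
for the split map, each written H with derivative dH in the direction of 𝓛: τ(HX·Y) is skew; dH(HX)Y
− dH(HY)X is again in the image, equal to H(B(X, Y)); and the cyclic sum of τ(dH(HY)X·Z) is zero.

A vector field acts on operators coefficientwise, as a derivation commuting with `pos`, and its
value on 𝓛 is its own symbol (`lie_lax`). Therefore the commutator of ∂_{HX} and ∂_{HY} is the field
of H applied to B(X, Y) + ∂_{HX}Y − ∂_{HY}X, which proves that the image is a Lie subalgebra. In dω
the terms that differentiate X, Y, Z cancel by skewness, and what remains is the cyclic sum. This is
`isHamiltonianMap_of`.

The variational formula `act_integral` identifies ω(D, H(δg/δ𝓛)) with the derivative of g along D,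
so closedness of ω on the fields H(δf/δ𝓛) is the Jacobi identity
(`IsHamiltonianMap.isPoissonBracket`). Locality holds because composition with fixed operators and
projection preserve families whose coefficients are differential operators in the parameter.
Compatibility needs no further computation: A^{(z)} is Hamiltonian for every z, and rescaling its
bracket reaches every combination with a ≠ 0, while a = 0 is the second structure, treated on its
own. The class S enters only through the closure properties in `IsAdmissible`. -/

@[ext] theorem ext {P Q : PsiDO R} (h : ∀ i, P.coeff i = Q.coeff i) : P = Q :=
  Subtype.ext (funext h)

@[simp] theorem coeff_add (P Q : PsiDO R) (i : ℤ) : (P + Q).coeff i = P.coeff i + Q.coeff i := rfl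
@[simp] theorem coeff_sub (P Q : PsiDO R) (i : ℤ) : (P - Q).coeff i = P.coeff i - Q.coeff i := rfl
@[simp] theorem coeff_zero (i : ℤ) : (0 : PsiDO R).coeff i = 0 := rfl
@[simp] theorem coeff_smul (c : ℝ) (P : PsiDO R) (i : ℤ) : (c • P).coeff i = c • P.coeff i := rfl

theorem coeff_single (i : ℤ) (a : R) (j : ℤ) : (single i a).coeff j = if j = i then a else 0 := by
  simp [single, coeff, Pi.single_apply]

theorem coeff_pos (P : PsiDO R) (i : ℤ) : P.pos.coeff i = if 0 ≤ i then P.coeff i else 0 := rfl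

theorem coeff_negPart (P : PsiDO R) (i : ℤ) : P.neg.coeff i = if 0 ≤ i then 0 else P.coeff i := by
  rw [neg, coeff_sub, coeff_pos]
  split_ifs <;> simp

theorem exists_bound (P : PsiDO R) : ∃ N : ℤ, ∀ i, N < i → P.coeff i = 0 := P.2

/-- The coefficient at `∂ⁱ` as an additive map. -/
def coeffHom (i : ℤ) : PsiDO R →+ R where
  toFun P := P.coeff i
  map_zero' := rfl
  map_add' _ _ := rfl

theorem coeff_sum {ι : Type*} (s : Finset ι) (f : ι → PsiDO R) (i : ℤ) :
    (∑ x ∈ s, f x).coeff i = ∑ x ∈ s, (f x).coeff i :=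
  map_sum (coeffHom i) f s

/-- An additive map vanishing on monomials and on operators of very negative order is zero. -/
theorem addHom_eq_zero {G : Type*} [AddCommGroup G] (T : PsiDO R →+ G)
    (h1 : ∀ i a, T (single i a) = 0) (n : ℤ) (h2 : ∀ P : PsiDO R, (∀ i, n ≤ i → P.coeff i = 0) →
      T P = 0) (P : PsiDO R) : T P = 0 := by
  obtain ⟨N, hN⟩ := P.exists_bound
  have h := h2 (P - ∑ i ∈ Finset.Icc n N, single i (P.coeff i)) (by
    intro i hi
    rw [coeff_sub, coeff_sum]
    simp only [coeff_single, Finset.sum_ite_eq, Finset.mem_Icc, hi, true_and]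
    split_ifs with h
    · simp
    · simp [hN i (not_le.mp h)])
  rw [map_sub, map_sum, Finset.sum_eq_zero (fun i _ => h1 i _), sub_zero] at h
  exact h

/-! ### Composition: bilinearity, associativity, residues of commutators -/

section Mul

variable (D : Derivation ℝ R R)

theorem iterate_map_add (k : ℕ) (x y : R) : D^[k] (x + y) = D^[k] x + D^[k] y := by
  induction k with
  | zero => rfl
  | succ k ih => simp only [Function.iterate_succ_apply', ih, map_add]

theorem iterate_map_zero (k : ℕ) : D^[k] (0 : R) = 0 := Function.iterate_fixed (map_zero D) k

theorem iterate_map_smul (k : ℕ) (c : ℝ) (x : R) : D^[k] (c • x) = c • D^[k] x := by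
  induction k with
  | zero => rfl
  | succ k ih => simp only [Function.iterate_succ_apply', ih, Derivation.map_smul]

theorem iterate_map_zsmul (k : ℕ) (c : ℤ) (x : R) : D^[k] (c • x) = c • D^[k] x := by
  induction k with
  | zero => rfl
  | succ k ih => simp only [Function.iterate_succ_apply', ih, map_zsmul]

theorem iterate_leibniz (n : ℕ) (x y : R) :
    D^[n] (x * y) = ∑ p ∈ antidiagonal n, (n.choose p.1 : R) * (D^[p.1] x * D^[p.2] y) := by
  induction n with
  | zero => simp
  | succ n ih =>
    rw [Function.iterate_succ_apply', ih, map_sum,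
      sum_antidiagonal_choose_succ_mul (fun i j => D^[i] x * D^[j] y), ← sum_add_distrib]
    refine sum_congr rfl fun p hp => ?_
    have h : n.choose p.2 = n.choose p.1 :=
      Nat.choose_symm_of_eq_add (by rw [← HasAntidiagonal.mem_antidiagonal.mp hp]; ring)
    simp only [Derivation.leibniz, Derivation.map_natCast, smul_eq_mul,
      Function.iterate_succ_apply', h]
    ring

/-- The term of index `p` in the coefficient of `∂ˡ` of a product. -/
noncomputable def mulTerm (P Q : PsiDO R) (l : ℤ) (p : ℤ × ℕ) : R :=
  Ring.choose p.1 p.2 • (P.coeff p.1 * D^[p.2] (Q.coeff (l + p.2 - p.1)))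

theorem coeff_mul_eq_finsum (P Q : PsiDO R) (l : ℤ) :
    (mul D (map_zero D) P Q).coeff l = ∑ᶠ p, mulTerm D P Q l p := rfl

theorem coeff_mul_eq_sum_of_subset (P Q : PsiDO R) (l : ℤ) (s : Finset (ℤ × ℕ))
    (h : ∀ p, mulTerm D P Q l p ≠ 0 → p ∈ s) :
    (mul D (map_zero D) P Q).coeff l = ∑ p ∈ s, mulTerm D P Q l p :=
  finsum_eq_sum_of_support_subset _ (fun p hp => h p hp)

theorem mulTerm_ne_zero {P Q : PsiDO R} {l : ℤ} {p : ℤ × ℕ} (h : mulTerm D P Q l p ≠ 0) :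
    P.coeff p.1 ≠ 0 ∧ Q.coeff (l + p.2 - p.1) ≠ 0 := by
  constructor
  · intro h0
    exact h (by simp [mulTerm, h0])
  · intro h0
    exact h (by simp [mulTerm, h0])

/-- A box containing all the indices that contribute to the coefficient of `∂ˡ`. -/
noncomputable def box (M N l : ℤ) : Finset (ℤ × ℕ) := Finset.Icc (l - N) M ×ˢ Finset.range (M + N - l + 1).toNat

/-- The finite index set depends only on bounds for the orders, so products of different operators
with common bounds can be compared term by term. -/
theorem coeff_mul_eq_sum {P Q : PsiDO R} {M N : ℤ} (hP : ∀ i, M < i → P.coeff i = 0)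
    (hQ : ∀ i, N < i → Q.coeff i = 0) (l : ℤ) :
    (mul D (map_zero D) P Q).coeff l = ∑ p ∈ box M N l, mulTerm D P Q l p := by
  refine coeff_mul_eq_sum_of_subset D P Q l _ fun p hp => ?_
  obtain ⟨h1, h2⟩ := mulTerm_ne_zero D hp
  have h1 : p.1 ≤ M := not_lt.mp fun h => h1 (hP _ h)
  have h2 : l + p.2 - p.1 ≤ N := not_lt.mp fun h => h2 (hQ _ h)
  simp only [box, Finset.mem_product, Finset.mem_Icc, Finset.mem_range]
  omega

theorem coeff_mul_eq_zero {P Q : PsiDO R} {M N : ℤ} (hP : ∀ i, M < i → P.coeff i = 0)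
    (hQ : ∀ i, N < i → Q.coeff i = 0) {l : ℤ} (hl : M + N < l) :
    (mul D (map_zero D) P Q).coeff l = 0 := by
  rw [coeff_mul_eq_sum D hP hQ, Finset.sum_eq_zero]
  intro p hp
  simp only [box, Finset.mem_product, Finset.mem_Icc, Finset.mem_range] at hp
  omega

theorem mul_add' (P Q Q' : PsiDO R) : mul D (map_zero D) P (Q + Q') =
    mul D (map_zero D) P Q + mul D (map_zero D) P Q' := by
  obtain ⟨M, hM⟩ := P.exists_bound
  obtain ⟨N, hN⟩ := Q.exists_bound
  obtain ⟨N', hN'⟩ := Q'.exists_bound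
  ext l
  have h1 : ∀ i, max N N' < i → Q.coeff i = 0 := fun i hi => hN i (by omega)
  have h2 : ∀ i, max N N' < i → Q'.coeff i = 0 := fun i hi => hN' i (by omega)
  have h3 : ∀ i, max N N' < i → (Q + Q').coeff i = 0 := fun i hi => by
    rw [coeff_add, h1 i hi, h2 i hi, add_zero]
  rw [coeff_add, coeff_mul_eq_sum D hM h1, coeff_mul_eq_sum D hM h2, coeff_mul_eq_sum D hM h3,
    ← Finset.sum_add_distrib]
  refine Finset.sum_congr rfl fun p _ => ?_
  simp only [mulTerm, coeff_add, iterate_map_add, mul_add, smul_add]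

theorem add_mul' (P P' Q : PsiDO R) : mul D (map_zero D) (P + P') Q =
    mul D (map_zero D) P Q + mul D (map_zero D) P' Q := by
  obtain ⟨M, hM⟩ := Q.exists_bound
  obtain ⟨N, hN⟩ := P.exists_bound
  obtain ⟨N', hN'⟩ := P'.exists_bound
  ext l
  have h1 : ∀ i, max N N' < i → P.coeff i = 0 := fun i hi => hN i (by omega)
  have h2 : ∀ i, max N N' < i → P'.coeff i = 0 := fun i hi => hN' i (by omega)
  have h3 : ∀ i, max N N' < i → (P + P').coeff i = 0 := fun i hi => by
    rw [coeff_add, h1 i hi, h2 i hi, add_zero]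
  rw [coeff_add, coeff_mul_eq_sum D h1 hM, coeff_mul_eq_sum D h2 hM, coeff_mul_eq_sum D h3 hM,
    ← Finset.sum_add_distrib]
  refine Finset.sum_congr rfl fun p _ => ?_
  simp only [mulTerm, coeff_add, add_mul, smul_add]

theorem smul_mul' (c : ℝ) (P Q : PsiDO R) :
    mul D (map_zero D) (c • P) Q = c • mul D (map_zero D) P Q := by
  obtain ⟨M, hM⟩ := P.exists_bound
  obtain ⟨N, hN⟩ := Q.exists_bound
  ext l
  rw [coeff_smul, coeff_mul_eq_sum D hM hN, coeff_mul_eq_sum D (P := c • P)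
    (fun i hi => by rw [coeff_smul, hM i hi, smul_zero]) hN, Finset.smul_sum]
  refine Finset.sum_congr rfl fun p _ => ?_
  simp only [mulTerm, coeff_smul, smul_mul_assoc]
  rw [smul_comm]

theorem mul_smul' (c : ℝ) (P Q : PsiDO R) :
    mul D (map_zero D) P (c • Q) = c • mul D (map_zero D) P Q := by
  obtain ⟨M, hM⟩ := P.exists_bound
  obtain ⟨N, hN⟩ := Q.exists_bound
  ext l
  rw [coeff_smul, coeff_mul_eq_sum D hM hN, coeff_mul_eq_sum D (Q := c • Q) hM
    (fun i hi => by rw [coeff_smul, hN i hi, smul_zero]), Finset.smul_sum]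
  refine Finset.sum_congr rfl fun p _ => ?_
  simp only [mulTerm, coeff_smul, iterate_map_smul, mul_smul_comm]
  rw [smul_comm]

/-- The product as a biadditive map. -/
noncomputable def mulHom : PsiDO R →+ PsiDO R →+ PsiDO R :=
  AddMonoidHom.mk' (fun P => AddMonoidHom.mk' (mul D (map_zero D) P) (mul_add' D P))
    (fun P P' => by ext1 Q; exact add_mul' D P P' Q)

/-- Here `p.2` counts derivatives and `p.1` is only the complement to the slack `N`; summing over an
antidiagonal instead of a range prepares the triple sums used for associativity. -/
theorem coeff_mul_single (P : PsiDO R) (j : ℤ) (b : R) (l : ℤ) (N : ℕ)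
    (hP : ∀ i, l + N - j < i → P.coeff i = 0) :
    (mul D (map_zero D) P (single j b)).coeff l =
      ∑ p ∈ antidiagonal N, Ring.choose (l + p.2 - j) p.2 • (P.coeff (l + p.2 - j) * D^[p.2] b) := by
  classical
  rw [coeff_mul_eq_sum_of_subset D _ _ l
    ((antidiagonal N).image fun p => ((l + p.2 - j : ℤ), p.2)), Finset.sum_image]
  · refine Finset.sum_congr rfl fun p _ => ?_
    simp [mulTerm, coeff_single]
  · intro p hp q hq h
    simp only [Prod.mk.injEq] at h
    simp only [Finset.mem_coe, HasAntidiagonal.mem_antidiagonal] at hp hq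
    ext <;> omega
  · intro p hp
    obtain ⟨h1, h2⟩ := mulTerm_ne_zero D hp
    have h1 := not_lt.mp fun h => h1 (hP _ h)
    rw [coeff_single] at h2
    have h2 : l + p.2 - p.1 = j := by
      by_contra h
      simp [h] at h2
    simp only [Finset.mem_image, HasAntidiagonal.mem_antidiagonal, Prod.exists]
    exact ⟨N - p.2, p.2, by omega, by ext <;> simp; omega⟩

theorem coeff_single_mul (i : ℤ) (a : R) (Q : PsiDO R) (l : ℤ) (N : ℕ)
    (hQ : ∀ j, l + N - i < j → Q.coeff j = 0) :
    (mul D (map_zero D) (single i a) Q).coeff l =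
      ∑ p ∈ antidiagonal N, Ring.choose i p.1 • (a * D^[p.1] (Q.coeff (l + p.1 - i))) := by
  classical
  rw [coeff_mul_eq_sum_of_subset D _ _ l
    ((antidiagonal N).image fun p => (i, p.1)), Finset.sum_image]
  · refine Finset.sum_congr rfl fun p _ => ?_
    simp [mulTerm, coeff_single]
  · intro p hp q hq h
    simp only [Prod.mk.injEq] at h
    simp only [Finset.mem_coe, HasAntidiagonal.mem_antidiagonal] at hp hq
    ext <;> omega
  · intro p hp
    obtain ⟨h1, h2⟩ := mulTerm_ne_zero D hp
    have h2 := not_lt.mp fun h => h2 (hQ _ h)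
    rw [coeff_single] at h1
    have h1 : p.1 = i := by
      by_contra h
      simp [h] at h1
    simp only [Finset.mem_image, HasAntidiagonal.mem_antidiagonal, Prod.exists]
    exact ⟨p.2, N - p.2, by omega, by ext <;> simp; omega⟩

theorem coeff_single_mul_single (i j : ℤ) (a b : R) (l : ℤ) (k : ℕ) (h : l + k = i + j) :
    (mul D (map_zero D) (single i a) (single j b)).coeff l = Ring.choose i k • (a * D^[k] b) := by
  rw [coeff_mul_eq_finsum, finsum_eq_single _ (i, k)]
  · simp [mulTerm, coeff_single, show l + k - i = j by omega]
  · intro p hp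
    by_contra h0
    obtain ⟨h1, h2⟩ := mulTerm_ne_zero D h0
    rw [coeff_single] at h1 h2
    have h1 : p.1 = i := by
      by_contra h
      simp [h] at h1
    have h2 : l + p.2 - p.1 = j := by
      by_contra h
      simp [h] at h2
    exact hp (by ext <;> simp <;> omega)

theorem coeff_single_mul_single_eq_zero (i j : ℤ) (a b : R) (l : ℤ) (h : i + j < l) :
    (mul D (map_zero D) (single i a) (single j b)).coeff l = 0 :=
  coeff_mul_eq_zero D (fun k hk => by simp [coeff_single, hk.ne'])
    (fun k hk => by simp [coeff_single, hk.ne']) h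

theorem sum_antidiagonal_assoc {G : Type*} [AddCommMonoid G] (N : ℕ) (f : ℕ → ℕ → ℕ → G) :
    ∑ p ∈ antidiagonal N, ∑ q ∈ antidiagonal p.1, f q.1 q.2 p.2 =
      ∑ p ∈ antidiagonal N, ∑ q ∈ antidiagonal p.2, f p.1 q.1 q.2 := by
  rw [Finset.sum_sigma', Finset.sum_sigma']
  refine Finset.sum_nbij' (fun x => ⟨(x.2.1, x.2.2 + x.1.2), (x.2.2, x.1.2)⟩)
    (fun x => ⟨(x.1.1 + x.2.1, x.2.2), (x.1.1, x.2.1)⟩) ?_ ?_ ?_ ?_ ?_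
  all_goals rintro ⟨⟨a, b⟩, ⟨c, d⟩⟩ h
  all_goals simp only [Finset.mem_sigma, HasAntidiagonal.mem_antidiagonal] at h ⊢
  all_goals obtain ⟨h1, h2⟩ := h
  · exact ⟨by omega, trivial⟩
  · exact ⟨by omega, trivial⟩
  · subst h2; rfl
  · subst h2; rfl

/-- With N = i + j + k − l, both sides are sums over s + t + r = N of one term `F s t r`. On the
right this comes from the Leibniz rule and C(i, s+t)·C(s+t, s) = C(i, s)·C(i−s, t); on the left from
the Vandermonde identity for C(i−s+j, t+r). -/
theorem single_mul_assoc (i j k : ℤ) (a b c : R) :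
    mul D (map_zero D) (mul D (map_zero D) (single i a) (single j b)) (single k c) =
      mul D (map_zero D) (single i a) (mul D (map_zero D) (single j b) (single k c)) := by
  have hs : ∀ (i : ℤ) (a : R) (l : ℤ), i < l → (single i a).coeff l = 0 := fun i a l hl => by
    simp [coeff_single, hl.ne']
  ext l
  rcases lt_or_ge (i + j + k) l with hl | hl
  · rw [coeff_mul_eq_zero D (M := i + j) (N := k) (fun t ht =>
      coeff_mul_eq_zero D (hs i a) (hs j b) ht) (hs k c) hl,
      coeff_mul_eq_zero D (M := i) (N := j + k) (hs i a) (fun t ht =>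
      coeff_mul_eq_zero D (hs j b) (hs k c) ht) (by omega)]
  obtain ⟨N, hN⟩ := Int.eq_ofNat_of_zero_le (sub_nonneg.mpr hl)
  rw [coeff_mul_single D _ k c l N (fun t ht => coeff_mul_eq_zero D (hs i a) (hs j b) (by omega)),
    coeff_single_mul D i a _ l N (fun t ht => coeff_mul_eq_zero D (hs j b) (hs k c) (by omega))]
  have h1 : ∀ p ∈ antidiagonal N, (mul D (map_zero D) (single i a) (single j b)).coeff
      (l + p.2 - k) = Ring.choose i p.1 • (a * D^[p.1] b) := fun p hp => by
    rw [HasAntidiagonal.mem_antidiagonal] at hp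
    exact coeff_single_mul_single D i j a b _ p.1 (by omega)
  have h2 : ∀ p ∈ antidiagonal N, (mul D (map_zero D) (single j b) (single k c)).coeff
      (l + p.1 - i) = Ring.choose j p.2 • (b * D^[p.2] c) := fun p hp => by
    rw [HasAntidiagonal.mem_antidiagonal] at hp
    exact coeff_single_mul_single D j k b c _ p.2 (by omega)
  let F : ℕ → ℕ → ℕ → R := fun s t r =>
    (Ring.choose i s * Ring.choose (i - s) t * Ring.choose j r) • (a * (D^[s] b * D^[t + r] c))
  have hR : ∀ p ∈ antidiagonal N,
      Ring.choose i p.1 • (a * D^[p.1] ((mul D (map_zero D) (single j b) (single k c)).coeff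
        (l + p.1 - i))) = ∑ q ∈ antidiagonal p.1, F q.1 q.2 p.2 := fun p hp => by
    rw [h2 p hp, iterate_map_zsmul, iterate_leibniz, Finset.smul_sum, Finset.mul_sum,
      Finset.smul_sum]
    refine Finset.sum_congr rfl fun q hq => ?_
    rw [HasAntidiagonal.mem_antidiagonal] at hq
    have hc := Ring.choose_smul_choose i (show q.1 ≤ p.1 by omega)
    rw [show p.1 - q.1 = q.2 by omega, nsmul_eq_mul] at hc
    simp only [F]
    rw [← hc, ← Function.iterate_add_apply]
    simp only [zsmul_eq_mul]
    push_cast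
    ring
  rw [Finset.sum_congr rfl hR, sum_antidiagonal_assoc]
  refine Finset.sum_congr rfl fun p hp => ?_
  rw [h1 p hp]
  have hp' := hp
  rw [HasAntidiagonal.mem_antidiagonal] at hp
  have hv := Ring.add_choose_eq (r := i - p.1) (s := j) p.2 (Commute.all _ _)
  rw [show l + p.2 - k = i - p.1 + j by omega, hv]
  have : ∀ q ∈ antidiagonal p.2, F p.1 q.1 q.2 =
    (Ring.choose (i - p.1 : ℤ) q.1 * Ring.choose j q.2) •
      (Ring.choose i p.1 • (a * D^[p.1] b) * D^[p.2] c) := fun q hq => by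
    rw [HasAntidiagonal.mem_antidiagonal] at hq
    simp only [F, hq, zsmul_eq_mul]
    push_cast
    ring
  rw [Finset.sum_congr rfl this, Finset.sum_smul]

/-- The coefficient `T` of the associator is additive in each argument and vanishes once the total
order drops below `l`. By `addHom_eq_zero` each argument can then be replaced by monomials, one
after the other: the third, the second, the first. -/
theorem mul_assoc' (P Q R' : PsiDO R) :
    mul D (map_zero D) (mul D (map_zero D) P Q) R' =
      mul D (map_zero D) P (mul D (map_zero D) Q R') := by
  let μ := mulHom D
  have hμ : ∀ P Q, μ P Q = mul D (map_zero D) P Q := fun _ _ => rfl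
  rw [← sub_eq_zero]
  ext l
  rw [coeff_zero]
  have hs : ∀ (i : ℤ) (a : R) (l : ℤ), i < l → (single i a).coeff l = 0 := fun i a l hl => by
    simp [coeff_single, hl.ne']
  let T : PsiDO R → PsiDO R → PsiDO R →+ R := fun P Q =>
    (coeffHom l).comp (μ (μ P Q) - (μ P).comp (μ Q))
  have hT : ∀ P Q S, T P Q S = (mul D (map_zero D) (mul D (map_zero D) P Q) S -
      mul D (map_zero D) P (mul D (map_zero D) Q S)).coeff l := fun _ _ _ => rfl
  have low : ∀ {P Q S : PsiDO R} {M N K : ℤ}, (∀ i, M < i → P.coeff i = 0) →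
      (∀ i, N < i → Q.coeff i = 0) → (∀ i, K < i → S.coeff i = 0) → M + N + K < l →
      T P Q S = 0 := fun {P Q S M N K} hP hQ hS hl => by
    rw [hT, coeff_sub, coeff_mul_eq_zero D (M := M + N) (N := K)
      (fun t ht => coeff_mul_eq_zero D hP hQ ht) hS hl,
      coeff_mul_eq_zero D (M := M) (N := N + K) hP
      (fun t ht => coeff_mul_eq_zero D hQ hS ht) (by omega), sub_zero]
  have step1 : ∀ i a j b S, T (single i a) (single j b) S = 0 := fun i a j b S => by
    refine addHom_eq_zero (T (single i a) (single j b)) (fun k c => ?_) (l - i - j) (fun S hS => ?_) S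
    · rw [hT, single_mul_assoc, sub_self, coeff_zero]
    · exact low (hs i a) (hs j b) (K := l - i - j - 1) (fun t ht => hS t (by omega)) (by omega)
  have step2 : ∀ i a Q S, T (single i a) Q S = 0 := fun i a Q S => by
    obtain ⟨K, hK⟩ := S.exists_bound
    let U : PsiDO R →+ R := (coeffHom l).comp ((μ.flip S).comp (μ (single i a)) -
      (μ (single i a)).comp (μ.flip S))
    have hU : ∀ Q, U Q = T (single i a) Q S := fun _ => rfl
    rw [← hU]
    refine addHom_eq_zero U (fun k c => ?_) (l - i - K) (fun Q hQ => ?_) Q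
    · rw [hU, step1]
    · rw [hU]
      exact low (hs i a) (N := l - i - K - 1) (fun t ht => hQ t (by omega)) hK (by omega)
  obtain ⟨N, hN⟩ := Q.exists_bound
  obtain ⟨K, hK⟩ := R'.exists_bound
  let U : PsiDO R →+ R := (coeffHom l).comp ((μ.flip R').comp (μ.flip Q) - μ.flip (μ Q R'))
  have hU : ∀ P, U P = T P Q R' := fun _ => rfl
  rw [← hT, ← hU]
  refine addHom_eq_zero U (fun k c => ?_) (l - N - K) (fun P hP => ?_) P
  · rw [hU, step2]
  · rw [hU]
    exact low (M := l - N - K - 1) (fun t ht => hP t (by omega)) hN hK (by omega)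

theorem coeff_single_zero_mul (a : R) (Q : PsiDO R) (l : ℤ) :
    (mul D (map_zero D) (single 0 a) Q).coeff l = a * Q.coeff l := by
  rw [coeff_mul_eq_finsum, finsum_eq_single _ (0, 0)]
  · simp [mulTerm, coeff_single]
  · intro p hp
    by_contra h0
    have h1 := (mulTerm_ne_zero D h0).1
    rw [coeff_single] at h1
    have h1 : p.1 = 0 := by
      by_contra h
      simp [h] at h1
    apply h0
    have h2 : p.2 ≠ 0 := fun h => hp (by ext <;> simp [h1, h])
    simp [mulTerm, h1, Ring.choose_zero_pos ℤ (Nat.pos_of_ne_zero h2)]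

theorem one_mul' (Q : PsiDO R) : mul D (map_zero D) (single 0 1) Q = Q := by
  ext l
  rw [coeff_single_zero_mul, one_mul]

theorem coeff_mul_single_one (P : PsiDO R) (j l : ℤ) :
    (mul D (map_zero D) P (single j 1)).coeff l = P.coeff (l - j) := by
  rw [coeff_mul_eq_finsum, finsum_eq_single _ (l - j, 0)]
  · simp [mulTerm, coeff_single]
  · intro p hp
    by_contra h0
    have h1 := (mulTerm_ne_zero D h0).2
    rw [coeff_single] at h1
    have h1 : l + p.2 - p.1 = j := by
      by_contra h
      simp [h] at h1
    apply h0
    obtain ⟨k, hk⟩ := Nat.exists_eq_succ_of_ne_zero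
      (show p.2 ≠ 0 from fun h => hp (by ext <;> simp <;> omega))
    rw [mulTerm, h1, coeff_single, if_pos rfl, hk, Function.iterate_succ_apply,
      Derivation.map_one_eq_zero, iterate_map_zero, mul_zero, smul_zero]

theorem mul_one' (P : PsiDO R) : mul D (map_zero D) P (single 0 1) = P := by
  ext l
  rw [coeff_mul_single_one, sub_zero]

/-- A term with k ≥ 1 derivatives on `b` would come from the coefficient of ∂^{k−1} in `P`, and
C(k−1, k) = 0. -/
theorem res_mul_single_zero (P : PsiDO R) (b : R) :
    (mul D (map_zero D) P (single 0 b)).res = P.res * b := by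
  rw [res, coeff_mul_eq_finsum, finsum_eq_single _ (-1, 0)]
  · simp [mulTerm, coeff_single, res]
  · intro p hp
    by_contra h0
    have h1 := (mulTerm_ne_zero D h0).2
    rw [coeff_single] at h1
    have h1 : -1 + (p.2 : ℤ) - p.1 = 0 := by
      by_contra h
      simp [h] at h1
    apply h0
    have h2 : p.2 ≠ 0 := fun h => hp (by ext <;> simp <;> omega)
    have h3 : Ring.choose ((p.2 : ℤ) - 1) p.2 = 0 := by
      obtain ⟨k, hk⟩ := Nat.exists_eq_succ_of_ne_zero h2
      have := Ring.choose_natCast (R := ℤ) k (k + 1)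
      rw [Nat.choose_succ_self, Nat.cast_zero] at this
      rw [hk, ← this]
      push_cast
      congr 1
      ring
    rw [mulTerm, show p.1 = (p.2 : ℤ) - 1 by omega, h3, zero_smul]

/-- Integration by parts: `a Dᵏ b - (-1)ᵏ b Dᵏ a` is a total derivative. -/
theorem exists_eq_mul_iterate_sub (k : ℕ) (a b : R) :
    ∃ c, D c = a * D^[k] b - (-1) ^ k * (b * D^[k] a) := by
  induction k generalizing a b with
  | zero => exact ⟨0, by simp; ring⟩
  | succ k ih =>
    obtain ⟨c, hc⟩ := ih (D a) b
    refine ⟨a * D^[k] b - c, ?_⟩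
    rw [map_sub, hc, Derivation.leibniz, Function.iterate_succ_apply', Function.iterate_succ_apply]
    simp only [smul_eq_mul]
    ring

/-- The residue of a commutator is a total derivative. -/
theorem res_comm_mem_range (P Q : PsiDO R) :
    (mul D (map_zero D) P Q).res - (mul D (map_zero D) Q P).res ∈
      (LinearMap.range D.toLinearMap) := by
  let π : R →+ R ⧸ LinearMap.range D.toLinearMap := (Submodule.mkQ _).toAddMonoidHom
  have hπ : ∀ x, π x = 0 ↔ x ∈ LinearMap.range D.toLinearMap := fun x =>
    Submodule.Quotient.mk_eq_zero _
  rw [← hπ]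
  let μ := mulHom D
  have hs : ∀ (i : ℤ) (a : R) (l : ℤ), i < l → (single i a).coeff l = 0 := fun i a l hl => by
    simp [coeff_single, hl.ne']
  let T : PsiDO R → PsiDO R →+ R ⧸ LinearMap.range D.toLinearMap := fun P =>
    (π.comp (coeffHom (-1))).comp (μ P - μ.flip P)
  have hT : ∀ P Q, T P Q = π ((mul D (map_zero D) P Q).res - (mul D (map_zero D) Q P).res) :=
    fun _ _ => rfl
  have low : ∀ {P Q : PsiDO R} {M N : ℤ}, (∀ i, M < i → P.coeff i = 0) →
      (∀ i, N < i → Q.coeff i = 0) → M + N < -1 → T P Q = 0 := fun {P Q M N} hP hQ hl => by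
    rw [hT, res, res, coeff_mul_eq_zero D hP hQ hl, coeff_mul_eq_zero D hQ hP (by omega),
      sub_zero, map_zero]
  have step0 : ∀ i a j b, T (single i a) (single j b) = 0 := fun i a j b => by
    rcases lt_or_ge (i + j) (-1) with h | h
    · exact low (hs i a) (hs j b) h
    obtain ⟨k, hk⟩ := Int.eq_ofNat_of_zero_le (show 0 ≤ i + j + 1 by omega)
    rw [hT, hπ, res, res, coeff_single_mul_single D i j a b (-1) k (by omega),
      coeff_single_mul_single D j i b a (-1) k (by omega)]
    obtain ⟨c, hc⟩ := exists_eq_mul_iterate_sub D k a b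
    -- Reflection of binomials: since j = k − 1 − i, the two residues have the same coefficient up
    -- to the sign that integration by parts produces.
    have h1 : Ring.choose j k = (-1) ^ k * Ring.choose i k := by
      have := Ring.choose_neg (i - k + 1) k
      rw [show -(i - (k : ℤ) + 1) = j by omega, show i - (k : ℤ) + 1 + k - 1 = i by omega] at this
      rw [this, Units.smul_def, smul_eq_mul, Int.coe_negOnePow_natCast]
    refine ⟨Ring.choose i k • c, ?_⟩
    have h2 : D (Ring.choose i k • c) = Ring.choose i k • D c := map_zsmul D _ _
    change D (Ring.choose i k • c) = _
    rw [h2, hc, h1]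
    simp only [zsmul_eq_mul]
    push_cast
    ring
  have step1 : ∀ i a Q, T (single i a) Q = 0 := fun i a Q => by
    refine addHom_eq_zero _ (step0 i a) (-1 - i) (fun Q hQ => ?_) Q
    exact low (hs i a) (N := -2 - i) (fun t ht => hQ t (by omega)) (by omega)
  obtain ⟨N, hN⟩ := Q.exists_bound
  have hU : ∀ P, (-T Q) P = T P Q := fun P => by
    rw [AddMonoidHom.neg_apply, hT, hT, ← map_neg, neg_sub]
  rw [← hT, ← hU]
  refine addHom_eq_zero (-T Q) (fun i a => ?_) (-1 - N) (fun P hP => ?_) P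
  · rw [hU, step1]
  · rw [hU]
    exact low (M := -2 - N) (fun t ht => hP t (by omega)) hN (by omega)

end Mul

end PsiDO

end FrobKP

namespace FrobKP

/-! ### Identities in a ring with a splitting and an invariant trace -/

section RotaBaxter

/-- A splitting of a ring into two subrings, given by the projection `p` on the first one along the
second one. -/
structure IsSplitting {P : Type*} [Ring P] (p : P →+ P) : Prop where
  proj : ∀ a, p (p a) = p a
  mul_pos : ∀ a b, p (p a * p b) = p a * p b
  mul_neg : ∀ a b, p ((a - p a) * (b - p b)) = 0

/-- A trace for which both subrings of a splitting are isotropic. -/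
structure IsSplitTrace {P G : Type*} [Ring P] [AddCommGroup G] (p : P →+ P) (τ : P →+ G) :
    Prop where
  comm : ∀ a b, τ (a * b) = τ (b * a)
  pos : ∀ a b, τ (p a * p b) = 0
  neg : ∀ a b, τ ((a - p a) * (b - p b)) = 0

variable {P G : Type*} [Ring P] [AddCommGroup G] {p : P →+ P} {τ : P →+ G}

theorem IsSplitting.rotaBaxter (hp : IsSplitting p) (a b : P) :
    p (a * b) = p (p a * b) + p (a * p b) - p a * p b := by
  have h := hp.mul_neg a b
  rw [sub_mul, mul_sub, mul_sub, map_sub, map_sub, map_sub, hp.mul_pos] at h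
  rw [← sub_eq_zero, ← h]
  abel

variable (p) in
/-- The Adler mapping `X ↦ (LX)₊L - L(XL)₊`. -/
def adlerMap (L X : P) : P := p (L * X) * L - L * p (X * L)

variable (p) in
/-- The derivative of the Adler mapping in the direction `a`. -/
def adlerDeriv (L a X : P) : P :=
  p (a * X) * L + p (L * X) * a - (a * p (X * L) + L * p (X * a))

variable (p) in
/-- The one-form whose image under the Adler mapping is the algebraic part of the bracket of the
images of `X` and `Y`. -/
def adlerBracket (L X Y : P) : P :=
  Y * p (L * X) - p (X * L) * Y - X * p (L * Y) + p (Y * L) * X + X * L * Y - Y * L * X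

/-- Besides nested projections, the expansion contains p applied to LX·LY, LY·LX, XL·YL and YL·XL.
The Rota–Baxter identity for these four products makes everything cancel. -/
theorem adlerDeriv_sub (hp : IsSplitting p) (L X Y : P) :
    adlerDeriv p L (adlerMap p L X) Y - adlerDeriv p L (adlerMap p L Y) X =
      adlerMap p L (adlerBracket p L X Y) := by
  have h1 := hp.rotaBaxter (L * X) (L * Y)
  have h2 := hp.rotaBaxter (L * Y) (L * X)
  have h3 := hp.rotaBaxter (X * L) (Y * L)
  have h4 := hp.rotaBaxter (Y * L) (X * L)
  simp only [adlerDeriv, adlerMap, adlerBracket, mul_sub, sub_mul, mul_add, add_mul, map_add,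
    map_sub, mul_assoc] at *
  rw [h1, h2, h3, h4]
  simp only [mul_sub, sub_mul, mul_add, add_mul, mul_assoc]
  abel

/-- Isotropy of both halves makes `p` and `id - p` adjoint to each other with respect to τ. -/
theorem IsSplitTrace.proj_mul (h : IsSplitTrace p τ) (a b : P) :
    τ (p a * b) = τ (a * (b - p b)) := by
  have h1 := h.pos a b
  have h2 := h.neg a b
  rw [sub_mul, map_sub, sub_eq_zero] at h2
  rw [h2, mul_sub, map_sub, h1, sub_zero]

theorem IsSplitTrace.rotate (h : IsSplitTrace p τ) (a b c : P) :
    τ (a * (b * c)) = τ (b * (c * a)) := by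
  rw [h.comm, mul_assoc]

/-- The pairing is τ(p(LX)·LY) − τ(p(XL)·YL). By adjointness, symmetrizing the two terms in X and Y
gives τ(LX·LY) and τ(XL·YL), which agree by cyclicity. -/
theorem adlerMap_skew (h : IsSplitTrace p τ) (L X Y : P) :
    τ (adlerMap p L X * Y) = -τ (adlerMap p L Y * X) := by
  have e : ∀ X Y, τ (adlerMap p L X * Y) =
      τ (p (L * X) * (L * Y)) - τ (p (X * L) * (Y * L)) := fun X Y => by
    rw [adlerMap, sub_mul, map_sub, mul_assoc, mul_assoc, h.comm L, mul_assoc]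
  rw [e, e, h.proj_mul, h.proj_mul, h.comm _ (L * Y - _), h.comm _ (Y * L - _), sub_mul, sub_mul,
    map_sub, map_sub]
  have h1 : τ (L * Y * (L * X)) = τ (Y * L * (X * L)) := by
    rw [mul_assoc, h.comm, mul_assoc, mul_assoc, mul_assoc]
  rw [h1]
  abel

/-- The one-form dual to the vector `a` in `⟨H'_a X, Z⟩`. -/
theorem trace_adlerDeriv_mul (h : IsSplitTrace p τ) (L a X Z : P) :
    τ (adlerDeriv p L a X * Z) = τ (a * (X * (L * Z - p (L * Z)) + Z * p (L * X)
      - p (X * L) * Z - (Z * L - p (Z * L)) * X)) := by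
  have h1 : τ (p (a * X) * L * Z) = τ (a * (X * (L * Z - p (L * Z)))) := by
    rw [mul_assoc, h.proj_mul, mul_assoc]
  have h2 : τ (p (L * X) * a * Z) = τ (a * (Z * p (L * X))) := by
    rw [mul_assoc, h.rotate]
  have h3 : τ (L * p (X * a) * Z) = τ (a * ((Z * L - p (Z * L)) * X)) := by
    rw [mul_assoc, h.rotate, h.proj_mul, mul_assoc, h.rotate]
  rw [adlerDeriv, sub_mul, add_mul, add_mul, map_sub, map_add, map_add, h1, h2, h3, mul_assoc]
  simp only [mul_sub, mul_add, map_add, map_sub]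
  abel

/-- Split u, v and w into their two parts. Products of three parts from the same half have trace
zero, since each half is an isotropic subring; the mixed terms match after cyclic rotation. -/
theorem IsSplitTrace.cyclic_pos (hp : IsSplitting p) (h : IsSplitTrace p τ) (u v w : P) :
    (τ (p v * (u * (w - p w))) - τ (p v * (w * (u - p u)))) +
    (τ (p w * (v * (u - p u))) - τ (p w * (u * (v - p v)))) +
    (τ (p u * (w * (v - p v))) - τ (p u * (v * (w - p w)))) =
      τ (v * (u * w)) - τ (v * (w * u)) := by
  have h1 : ∀ a b c, τ (p a * (p b * p c)) = 0 := fun a b c => by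
    rw [← hp.mul_pos b c, h.pos]
  have h2 : ∀ a b c, τ ((a - p a) * ((b - p b) * (c - p c))) = 0 := fun a b c => by
    have := h.neg a ((b - p b) * (c - p c))
    rwa [hp.mul_neg, sub_zero] at this
  have e1 := h1 v u w
  have e2 := h1 v w u
  have e3 := h2 v u w
  have e4 := h2 v w u
  obtain ⟨a', ha⟩ : ∃ a', u = p u + a' := ⟨u - p u, by abel⟩
  obtain ⟨b', hb⟩ : ∃ b', v = p v + b' := ⟨v - p v, by abel⟩
  obtain ⟨c', hc⟩ : ∃ c', w = p w + c' := ⟨w - p w, by abel⟩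
  generalize p u = a, p v = b, p w = c at *
  subst ha hb hc
  simp only [add_sub_cancel_left] at *
  simp only [mul_add, add_mul, map_add]
  rw [e1, e2, e3, e4, h.rotate c b a', h.rotate c b' a', ← h.rotate b' c a, ← h.rotate b' c a',
    ← h.rotate b' a c, ← h.rotate b' a c', h.rotate a b c', h.rotate a b' c']
  abel

/-- Counterpart of `cyclic_pos` with the complementary factor in the middle; it serves the products
XL, YL, ZL as the other serves LX, LY, LZ. -/
theorem IsSplitTrace.cyclic_neg (hp : IsSplitting p) (h : IsSplitTrace p τ) (u v w : P) :
    (τ (p v * ((w - p w) * u)) - τ (p v * ((u - p u) * w))) +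
    (τ (p w * ((u - p u) * v)) - τ (p w * ((v - p v) * u))) +
    (τ (p u * ((v - p v) * w)) - τ (p u * ((w - p w) * v))) =
      τ (v * (w * u)) - τ (v * (u * w)) := by
  have h1 : ∀ a b c, τ (p a * (p b * p c)) = 0 := fun a b c => by
    rw [← hp.mul_pos b c, h.pos]
  have h2 : ∀ a b c, τ ((a - p a) * ((b - p b) * (c - p c))) = 0 := fun a b c => by
    have := h.neg a ((b - p b) * (c - p c))
    rwa [hp.mul_neg, sub_zero] at this
  have e1 := h1 v u w
  have e2 := h1 v w u
  have e3 := h2 v u w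
  have e4 := h2 v w u
  obtain ⟨a', ha⟩ : ∃ a', u = p u + a' := ⟨u - p u, by abel⟩
  obtain ⟨b', hb⟩ : ∃ b', v = p v + b' := ⟨v - p v, by abel⟩
  obtain ⟨c', hc⟩ : ∃ c', w = p w + c' := ⟨w - p w, by abel⟩
  generalize p u = a, p v = b, p w = c at *
  subst ha hb hc
  simp only [add_sub_cancel_left] at *
  simp only [mul_add, add_mul, map_add]
  rw [e1, e2, e3, e4, ← h.rotate b c a', ← h.rotate b' c a', ← h.rotate b a c',
    ← h.rotate b' a c', h.rotate c b' a, h.rotate c b' a', h.rotate a b' c, h.rotate a b' c']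
  abel

theorem adlerDeriv_cyclic (hp : IsSplitting p) (h : IsSplitTrace p τ) (L X Y Z : P) :
    τ (adlerDeriv p L (adlerMap p L Y) X * Z) + τ (adlerDeriv p L (adlerMap p L Z) Y * X)
      + τ (adlerDeriv p L (adlerMap p L X) Z * Y) = 0 := by
  let g : P → P → P → G := fun X Y Z => τ (p (L * X) * (L * (p (Y * L) * Z)))
  let f : P → P → P → G := fun u v w => τ (p v * (u * (w - p w))) - τ (p v * (w * (u - p u)))
  let f' : P → P → P → G := fun u v w => τ (p v * ((w - p w) * u)) - τ (p v * ((u - p u) * w))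
  -- The terms `f` involve only LX, LY, LZ and `f'` only XL, YL, ZL. The mixed terms `g` enter with
  -- signs that cancel in the cyclic sum, and the cyclic sums of `f` and `f'` are opposite by
  -- cyclicity of τ.
  have key : ∀ X Y Z, τ (adlerDeriv p L (adlerMap p L Y) X * Z) =
      f (L * X) (L * Y) (L * Z) + f' (X * L) (Y * L) (Z * L)
        - g Y X Z + g Y Z X + g Z Y X - g X Y Z := fun X Y Z => by
    have r : ∀ X Y Z, τ (p (Y * L) * (X * (p (L * Z) * L))) = g Z Y X := fun X Y Z => by
      simp only [g]
      rw [← mul_assoc, h.comm, mul_assoc]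
    have rL : ∀ a, τ (L * a) = τ (a * L) := fun a => h.comm L a
    have r5 := r X Y Z
    have r6 := r Z Y X
    rw [trace_adlerDeriv_mul h, ← r5, ← r6]
    simp only [adlerMap, f, f', g, mul_sub, sub_mul, mul_add, map_add, map_sub, mul_assoc, rL]
    abel
  have h1 := h.cyclic_pos hp (L * X) (L * Y) (L * Z)
  have h2 := h.cyclic_neg hp (X * L) (Y * L) (Z * L)
  have h3 : ∀ X Z, τ (L * Y * (L * X * (L * Z))) = τ (Y * L * (X * L * (Z * L))) := fun X Z => by
    rw [mul_assoc, h.comm]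
    simp only [mul_assoc]
  rw [key, key, key]
  calc _ = (f (L * X) (L * Y) (L * Z) + f (L * Y) (L * Z) (L * X) + f (L * Z) (L * X) (L * Y))
      + (f' (X * L) (Y * L) (Z * L) + f' (Y * L) (Z * L) (X * L)
        + f' (Z * L) (X * L) (Y * L)) := by abel
    _ = 0 := by
      rw [h1, h2, h3, h3]
      abel

variable (p) in
/-- The mapping `X ↦ [L₋, X₊]₋ - [L₊, X₋]₊`. -/
def splitMap (L X : P) : P :=
  ((L - p L) * p X - p X * (L - p L)) - p ((L - p L) * p X - p X * (L - p L))
    - p (p L * (X - p X) - (X - p X) * p L)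

variable (p) in
/-- The one-form whose image under `splitMap` is the algebraic part of the bracket of the images of
`X` and `Y`. -/
def splitBracket (X Y : P) : P :=
  (p X * p Y - p Y * p X) - ((X - p X) * (Y - p Y) - (Y - p Y) * (X - p X))

/-- In this form `L` is no longer decomposed, so linearity, the action of derivations and locality
can be read off directly. -/
theorem splitMap_eq (hp : IsSplitting p) (L X : P) :
    splitMap p L X = L * p X - p X * L - p (L * X) + p (X * L) := by
  rw [hp.rotaBaxter L X, hp.rotaBaxter X L]
  simp only [splitMap, mul_sub, sub_mul, map_sub, hp.mul_pos]
  abel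

/-- With c = [L₋, X₊] and d = [L₊, X₋], the inner value has parts c₋ and −d₊. Replacing c₋ by c and
d₊ by d changes nothing, as [c₊, Y₊] is removed by the outer projection to the negative part and
[d₋, Y₋] by the one to the positive part. The iterate thus decouples into double commutators. -/
theorem splitMap_splitMap (hp : IsSplitting p) (L X Y : P) :
    splitMap p (splitMap p L X) Y =
      (((L - p L) * p X - p X * (L - p L)) * p Y - p Y * ((L - p L) * p X - p X * (L - p L)))
      - p (((L - p L) * p X - p X * (L - p L)) * p Y - p Y * ((L - p L) * p X - p X * (L - p L)))
      + p ((p L * (X - p X) - (X - p X) * p L) * (Y - p Y)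
        - (Y - p Y) * (p L * (X - p X) - (X - p X) * p L)) := by
  generalize hc : (L - p L) * p X - p X * (L - p L) = c
  generalize hd : p L * (X - p X) - (X - p X) * p L = d
  have h1 : p (splitMap p L X) = -p d := by
    rw [splitMap, hc, hd, map_sub, map_sub, hp.proj, hp.proj, sub_self, zero_sub]
  have h2 : splitMap p L X - p (splitMap p L X) = c - p c := by
    rw [h1, splitMap, hc, hd]
    abel
  rw [splitMap, h2, h1]
  simp only [mul_sub, sub_mul, map_sub, hp.mul_pos, neg_mul, mul_neg, map_neg]
  rw [hp.rotaBaxter d Y, hp.rotaBaxter Y d]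
  abel

/-- After the decoupling this is the Jacobi identity for commutators, once with X₊, Y₊ and once with
X₋, Y₋; the opposite signs of the two summands of `splitBracket` match those of `splitMap`. -/
theorem splitMap_sub (hp : IsSplitting p) (L X Y : P) :
    splitMap p (splitMap p L X) Y - splitMap p (splitMap p L Y) X =
      splitMap p L (splitBracket p X Y) := by
  have h1 : p (splitBracket p X Y) = p X * p Y - p Y * p X := by
    rw [splitBracket, map_sub, map_sub, map_sub, hp.mul_pos, hp.mul_pos, hp.mul_neg, hp.mul_neg,
      sub_self, sub_zero]
  have h2 : splitBracket p X Y - p (splitBracket p X Y) =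
      -((X - p X) * (Y - p Y) - (Y - p Y) * (X - p X)) := by
    rw [h1, splitBracket]
    abel
  rw [splitMap_splitMap hp, splitMap_splitMap hp, splitMap, h2, h1]
  generalize X - p X = x', Y - p Y = y', L - p L = l', p X = x, p Y = y, p L = l
  simp only [mul_sub, sub_mul, map_sub, mul_neg, neg_mul, map_neg, mul_assoc]
  abel

theorem IsSplitTrace.neg_mul (h : IsSplitTrace p τ) (a b : P) :
    τ ((a - p a) * b) = τ (a * p b) := by
  rw [sub_mul, map_sub, h.proj_mul, mul_sub, map_sub, sub_sub_cancel]

/-- By adjointness and rotation the pairing is τ(L₋[X₊, Y₊]) − τ(L₊[X₋, Y₋]), which is visibly skew.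
-/
theorem splitMap_skew (h : IsSplitTrace p τ) (L X Y : P) :
    τ (splitMap p L X * Y) = -τ (splitMap p L Y * X) := by
  have e : ∀ X Y, τ (splitMap p L X * Y) = τ ((L - p L) * (p X * p Y - p Y * p X))
      - τ (p L * ((X - p X) * (Y - p Y) - (Y - p Y) * (X - p X))) := fun X Y => by
    rw [splitMap, sub_mul, map_sub, h.neg_mul, h.proj_mul]
    simp only [sub_mul ((_ : P) * _) (_ * _), mul_sub _ ((_ : P) * _) (_ * _), map_sub τ, mul_assoc]
    rw [h.rotate (p X), h.rotate (X - p X)]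
  rw [e, e, ← neg_sub (p X * p Y), ← neg_sub ((X - p X) * (Y - p Y)), mul_neg, mul_neg, map_neg,
    map_neg]
  abel

/-- Moving `a` to the front by cyclicity leaves each ordering of x, y, z with total coefficient
zero. -/
theorem IsSplitTrace.jacobi (h : IsSplitTrace p τ) (a x y z : P) :
    τ (((a * y - y * a) * x - x * (a * y - y * a)) * z)
      + τ (((a * z - z * a) * y - y * (a * z - z * a)) * x)
      + τ (((a * x - x * a) * z - z * (a * x - x * a)) * y) = 0 := by
  have r1 : ∀ x y z, τ (y * (a * (x * z))) = τ (a * (x * (z * y))) := fun x y z => by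
    rw [h.comm, mul_assoc, mul_assoc]
  have r2 : ∀ x y z, τ (x * (y * (a * z))) = τ (a * (z * (x * y))) := fun x y z => by
    rw [← mul_assoc, h.comm, mul_assoc]
  simp only [mul_sub, sub_mul, mul_assoc, map_sub, r1, r2]
  abel

theorem splitMap_cyclic (hp : IsSplitting p) (h : IsSplitTrace p τ) (L X Y Z : P) :
    τ (splitMap p (splitMap p L Y) X * Z) + τ (splitMap p (splitMap p L Z) Y * X)
      + τ (splitMap p (splitMap p L X) Z * Y) = 0 := by
  have e : ∀ X Y Z, τ (splitMap p (splitMap p L Y) X * Z) =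
      τ ((((L - p L) * p Y - p Y * (L - p L)) * p X - p X * ((L - p L) * p Y - p Y * (L - p L)))
        * p Z) + τ (((p L * (Y - p Y) - (Y - p Y) * p L) * (X - p X)
        - (X - p X) * (p L * (Y - p Y) - (Y - p Y) * p L)) * (Z - p Z)) := fun X Y Z => by
    rw [splitMap_splitMap hp, add_mul, map_add, h.neg_mul, h.proj_mul]
  have h1 := h.jacobi (L - p L) (p X) (p Y) (p Z)
  have h2 := h.jacobi (p L) (X - p X) (Y - p Y) (Z - p Z)
  rw [e, e, e, ← add_zero (0 : G)]
  nth_rewrite 1 [← h1]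
  rw [← h2]
  abel

/-- The terms quadratic in the central element are z²·pX − z²·pX, so the Adler map is affine in z.
-/
theorem adlerMap_sub (hp : IsSplitting p) (L X z : P) (hz : ∀ a, a * z = z * a)
    (hpz : ∀ a, p (z * a) = z * p a) :
    adlerMap p (L - z) X = adlerMap p L X + z * splitMap p L X := by
  have hz' : ∀ a b, a * (z * b) = z * (a * b) := fun a b => by rw [← mul_assoc, hz, mul_assoc]
  rw [splitMap_eq hp]
  simp only [adlerMap, mul_sub, sub_mul, mul_add, map_sub, hz, hz', hpz, mul_assoc]
  abel

end RotaBaxter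

end FrobKP

namespace FrobKP

open MvPolynomial

/-! ### Extending derivations from real to algebra-valued differential polynomials -/

section Poly

variable {m n : ℕ} {A : Type*} [CommRing A] [Algebra ℝ A]

/-- The derivation of the `A`-valued differential polynomials induced by a derivation of the real
ones. -/
noncomputable def extDer (D : Derivation ℝ (DPoly m n ℝ) (DPoly m n ℝ)) :
    Derivation A (DPoly m n A) (DPoly m n A) :=
  mkDerivation A fun p => MvPolynomial.map (algebraMap ℝ A) (D (X p))

theorem extDer_map (D : Derivation ℝ (DPoly m n ℝ) (DPoly m n ℝ)) (f : DPoly m n ℝ) :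
    extDer D (MvPolynomial.map (algebraMap ℝ A) f) = MvPolynomial.map (algebraMap ℝ A) (D f) := by
  induction f using MvPolynomial.induction_on with
  | C a =>
    rw [map_C, ← algebraMap_eq, ← algebraMap_eq, Derivation.map_algebraMap,
      Derivation.map_algebraMap, map_zero]
  | add p q hp hq => simp only [map_add, hp, hq]
  | mul_X p i hp =>
    simp only [map_mul, Derivation.leibniz, hp, map_X, smul_eq_mul, map_add]
    rw [extDer, mkDerivation_X]

theorem extDer_tensor (D : Derivation ℝ (DPoly m n ℝ) (DPoly m n ℝ)) (f : DPoly m n ℝ) (a : A) :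
    extDer D (tensor f a) = tensor (D f) a := by
  rw [tensor, Derivation.leibniz, extDer_map, ← algebraMap_eq, Derivation.map_algebraMap,
    smul_zero, add_zero, smul_eq_mul, algebraMap_eq, tensor]

theorem monomial_eq_tensor (t : Jet m n →₀ ℕ) (a : A) :
    monomial t a = tensor (monomial t (1 : ℝ)) a := by
  rw [tensor, map_monomial, map_one, C_mul_monomial, mul_one]

theorem mapCoeff_extDer (D : Derivation ℝ (DPoly m n ℝ) (DPoly m n ℝ)) (φ : A →ₗ[ℝ] ℝ)
    (F : DPoly m n A) : mapCoeff φ (extDer D F) = D (mapCoeff φ F) := by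
  induction F using MvPolynomial.induction_on' with
  | monomial t a =>
    rw [monomial_eq_tensor, extDer_tensor, mapCoeff_tensor, mapCoeff_tensor, Derivation.map_smul]
  | add p q hp hq => simp only [map_add, hp, hq]

theorem extDer_dx : extDer (dx ℝ) = dx (m := m) (n := n) A := by
  apply derivation_ext
  intro p
  simp [extDer, dx, mkDerivation_X]

theorem mapCoeff_dx (φ : A →ₗ[ℝ] ℝ) (F : DPoly m n A) :
    mapCoeff φ (dx A F) = dx ℝ (mapCoeff φ F) := by
  rw [← extDer_dx, mapCoeff_extDer]

theorem mapCoeff_iterate_dx (φ : A →ₗ[ℝ] ℝ) (k : ℕ) (F : DPoly m n A) :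
    mapCoeff φ ((dx A)^[k] F) = (dx ℝ)^[k] (mapCoeff φ F) := by
  induction k with
  | zero => rfl
  | succ k ih => rw [Function.iterate_succ_apply', mapCoeff_dx, ih, Function.iterate_succ_apply']

theorem extDer_comm_dx (D : VectorField m n) (F : DPoly m n A) :
    extDer D.1 (dx A F) = dx A (extDer D.1 F) := by
  have h : ⁅extDer (A := A) D.1, dx (m := m) (n := n) A⁆ = 0 := by
    apply derivation_ext
    intro p
    rw [Derivation.commutator_apply, ← extDer_dx (A := A)]
    have hX : (X p : DPoly m n A) = MvPolynomial.map (algebraMap ℝ A) (X p) := (map_X _ _).symm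
    rw [hX, extDer_map, extDer_map, extDer_map, extDer_map, D.2, sub_self]
    rfl
  have h2 := congrArg (fun d : Derivation A (DPoly m n A) (DPoly m n A) => d F) h
  simpa [Derivation.commutator_apply, sub_eq_zero] using h2

theorem sum_tensor_coord (e : Module.Basis (Fin n) ℝ A) (F : DPoly m n A) :
    ∑ q, tensor (mapCoeff (e.coord q) F) (e q) = F := by
  ext t
  rw [coeff_sum]
  simp only [tensor, coeff_C_mul, coeff_map, coeff_mapCoeff]
  conv_rhs => rw [← e.sum_repr (coeff t F)]
  refine Finset.sum_congr rfl fun q _ => ?_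
  rw [mul_comm, ← Algebra.smul_def, Module.Basis.coord_apply]

theorem tensor_add (f g : DPoly m n ℝ) (a : A) : tensor (f + g) a = tensor f a + tensor g a := by
  simp [tensor, mul_add]

theorem tensor_sub (f g : DPoly m n ℝ) (a : A) : tensor (f - g) a = tensor f a - tensor g a := by
  simp [tensor, mul_sub]

theorem tensor_smul (c : ℝ) (f : DPoly m n ℝ) (a : A) : tensor (c • f) a = c • tensor f a := by
  ext t
  simp only [tensor, coeff_C_mul, coeff_map, coeff_smul, smul_eq_mul, map_mul]
  rw [Algebra.smul_def]
  ring

/-! ### The ring of pseudo-differential operators -/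

/-- The derivation `∂` as a real derivation. -/
noncomputable def dxR (m n : ℕ) (A : Type*) [CommRing A] [Algebra ℝ A] :
    Derivation ℝ (DPoly m n A) (DPoly m n A) := (dx A).restrictScalars ℝ

/-- The product is definitionally `comp`, so the abstract identities for splittings apply to the
given formulas without translation. -/
noncomputable instance : Ring (PsiDO (DPoly m n A)) where
  __ := (inferInstance : AddCommGroup (PsiDO (DPoly m n A)))
  mul := comp
  one := PsiDO.single 0 1
  left_distrib := PsiDO.mul_add' (dxR m n A)
  right_distrib := PsiDO.add_mul' (dxR m n A)
  mul_assoc := PsiDO.mul_assoc' (dxR m n A)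
  one_mul := PsiDO.one_mul' (dxR m n A)
  mul_one := PsiDO.mul_one' (dxR m n A)
  zero_mul P := map_zero ((PsiDO.mulHom (dxR m n A)).flip P)
  mul_zero P := map_zero (PsiDO.mulHom (dxR m n A) P)

theorem PsiDO.one_eq : (1 : PsiDO (DPoly m n A)) = PsiDO.single 0 1 := rfl

noncomputable instance : Algebra ℝ (PsiDO (DPoly m n A)) :=
  Algebra.ofModule (PsiDO.smul_mul' (dxR m n A)) (PsiDO.mul_smul' (dxR m n A))

theorem PsiDO.coeff_mul_eq (P Q : PsiDO (DPoly m n A)) (l : ℤ) :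
    ∃ s : Finset (ℤ × ℕ), (P * Q).coeff l = ∑ p ∈ s,
      Ring.choose p.1 p.2 • (P.coeff p.1 * (dx A)^[p.2] (Q.coeff (l + p.2 - p.1))) := by
  obtain ⟨M, hM⟩ := P.exists_bound
  obtain ⟨N, hN⟩ := Q.exists_bound
  exact ⟨_, PsiDO.coeff_mul_eq_sum (dxR m n A) hM hN l⟩

theorem PsiDO.coeff_mul_of_order_le {P Q : PsiDO (DPoly m n A)} {M N : ℤ}
    (hP : ∀ i, M < i → P.coeff i = 0) (hQ : ∀ i, N < i → Q.coeff i = 0) :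
    ∀ l, M + N < l → (P * Q).coeff l = 0 :=
  fun _ => PsiDO.coeff_mul_eq_zero (dxR m n A) hP hQ

/-- `P ↦ P₊` as an additive map. -/
def PsiDO.posHom {R : Type*} [CommRing R] [Algebra ℝ R] : PsiDO R →+ PsiDO R where
  toFun := PsiDO.pos
  map_zero' := by ext i; simp [PsiDO.coeff_pos]
  map_add' P Q := by
    ext i
    simp only [PsiDO.coeff_pos, PsiDO.coeff_add]
    split_ifs <;> simp

@[simp] theorem PsiDO.posHom_apply {R : Type*} [CommRing R] [Algebra ℝ R] (P : PsiDO R) :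
    PsiDO.posHom P = P.pos := rfl

theorem PsiDO.pos_smul {R : Type*} [CommRing R] [Algebra ℝ R] (c : ℝ) (P : PsiDO R) :
    (c • P).pos = c • P.pos := by
  ext i
  simp only [PsiDO.coeff_pos, PsiDO.coeff_smul]
  split_ifs <;> simp

theorem PsiDO.pos_eq_self {R : Type*} [CommRing R] [Algebra ℝ R] {P : PsiDO R}
    (h : ∀ i < 0, P.coeff i = 0) : P.pos = P := by
  ext i
  rw [PsiDO.coeff_pos]
  split_ifs with hi
  · rfl
  · rw [h i (not_le.mp hi)]

/-- A negative power of ∂ requires more derivatives than the exponent i ≥ 0 allows, and C(i, k) = 0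
for k > i. -/
theorem PsiDO.coeff_pos_mul_pos (P Q : PsiDO (DPoly m n A)) (l : ℤ) (hl : l < 0) :
    (P.pos * Q.pos).coeff l = 0 := by
  obtain ⟨s, hs⟩ := PsiDO.coeff_mul_eq P.pos Q.pos l
  rw [hs]
  refine Finset.sum_eq_zero fun p _ => ?_
  rw [PsiDO.coeff_pos, PsiDO.coeff_pos]
  split_ifs with h1 h2
  · obtain ⟨i, hi⟩ := Int.eq_ofNat_of_zero_le h1
    have : Ring.choose p.1 p.2 = 0 := by
      rw [hi]
      exact (Ring.choose_natCast (R := ℤ) i p.2).trans (by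
        rw [Nat.choose_eq_zero_of_lt (by omega), Nat.cast_zero])
    rw [this, zero_smul]
  · rw [Function.iterate_fixed (map_zero (dx A)), mul_zero, smul_zero]
  · rw [zero_mul, smul_zero]
  · rw [zero_mul, smul_zero]

theorem PsiDO.coeff_neg_mul_neg (P Q : PsiDO (DPoly m n A)) (l : ℤ) (hl : -2 < l) :
    (P.neg * Q.neg).coeff l = 0 :=
  PsiDO.coeff_mul_of_order_le (M := -1) (N := -1)
    (fun i hi => by rw [PsiDO.coeff_negPart, if_pos (by omega)])
    (fun i hi => by rw [PsiDO.coeff_negPart, if_pos (by omega)]) l (by omega)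

theorem PsiDO.isSplitting : IsSplitting (PsiDO.posHom (R := DPoly m n A)) where
  proj P := PsiDO.pos_eq_self fun i hi => by
    rw [PsiDO.posHom_apply, PsiDO.coeff_pos, if_neg (not_le.mpr hi)]
  mul_pos P Q := PsiDO.pos_eq_self fun i hi => PsiDO.coeff_pos_mul_pos P Q i hi
  mul_neg P Q := by
    ext i : 1
    rw [PsiDO.posHom_apply, PsiDO.coeff_pos]
    split_ifs with hi
    · exact PsiDO.coeff_neg_mul_neg P Q i (by omega)
    · rfl

/-- `P ↦ tr ∫ res P dx` as a linear map. -/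
noncomputable def trIntResHom (tr : TraceForm A) : PsiDO (DPoly m n A) →ₗ[ℝ] Functional m n where
  toFun := trIntRes tr
  map_add' P Q := by simp [trIntRes, PsiDO.res]
  map_smul' c P := by simp [trIntRes, PsiDO.res]

@[simp] theorem trIntResHom_apply (tr : TraceForm A) (P : PsiDO (DPoly m n A)) :
    trIntResHom tr P = trIntRes tr P := rfl

theorem integral_mapCoeff_dx (φ : A →ₗ[ℝ] ℝ) (F : DPoly m n A) :
    integral (mapCoeff φ (dx A F)) = 0 := by
  rw [mapCoeff_dx]
  exact (Submodule.Quotient.mk_eq_zero _).mpr ⟨_, rfl⟩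

theorem isSplitTrace (tr : TraceForm A) : IsSplitTrace (PsiDO.posHom (R := DPoly m n A))
    (trIntResHom (m := m) (n := n) tr).toAddMonoidHom where
  comm P Q := by
    obtain ⟨c, hc⟩ := PsiDO.res_comm_mem_range (dxR m n A) P Q
    rw [← sub_eq_zero, ← map_sub]
    change integral (mapCoeff tr.form (PsiDO.res (P * Q - Q * P))) = 0
    have : PsiDO.res (P * Q - Q * P) = dx A c := hc.symm
    rw [this, integral_mapCoeff_dx]
  pos P Q := by
    have : PsiDO.res (P.pos * Q.pos) = 0 := PsiDO.coeff_pos_mul_pos P Q (-1) (by omega)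
    change integral (mapCoeff tr.form (PsiDO.res (P.pos * Q.pos))) = 0
    rw [this, map_zero, map_zero]
  neg P Q := by
    have : PsiDO.res (P.neg * Q.neg) = 0 := PsiDO.coeff_neg_mul_neg P Q (-1) (by omega)
    change integral (mapCoeff tr.form (PsiDO.res (P.neg * Q.neg))) = 0
    rw [this, map_zero, map_zero]

/-! ### Derivations of the coefficients -/

/-- The coefficientwise action of a vector field. -/
noncomputable def PsiDO.lie (D : VectorField m n) :
    PsiDO (DPoly m n A) →ₗ[ℝ] PsiDO (DPoly m n A) where
  toFun P := ⟨fun i => extDer D.1 (P.coeff i), by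
    obtain ⟨N, hN⟩ := P.exists_bound
    exact ⟨N, fun i hi => by simp only [hN i hi, map_zero]⟩⟩
  map_add' P Q := Subtype.ext (funext fun i => map_add _ _ _)
  map_smul' c P := Subtype.ext (funext fun i =>
    ((extDer D.1).restrictScalars ℝ).map_smul c (P.coeff i))

theorem PsiDO.coeff_lie (D : VectorField m n) (P : PsiDO (DPoly m n A)) (i : ℤ) :
    (PsiDO.lie D P).coeff i = extDer D.1 (P.coeff i) := rfl

theorem PsiDO.lie_pos (D : VectorField m n) (P : PsiDO (DPoly m n A)) :
    PsiDO.lie D P.pos = (PsiDO.lie D P).pos := by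
  ext i : 1
  rw [PsiDO.coeff_lie, PsiDO.coeff_pos, PsiDO.coeff_pos, PsiDO.coeff_lie]
  split_ifs
  · rfl
  · exact map_zero _

theorem extDer_comm_iterate_dx (D : VectorField m n) (k : ℕ) (F : DPoly m n A) :
    extDer D.1 ((dx A)^[k] F) = (dx A)^[k] (extDer D.1 F) := by
  induction k with
  | zero => rfl
  | succ k ih =>
    rw [Function.iterate_succ_apply', extDer_comm_dx, ih, Function.iterate_succ_apply']

theorem PsiDO.lie_mul (D : VectorField m n) (P Q : PsiDO (DPoly m n A)) :
    PsiDO.lie D (P * Q) = PsiDO.lie D P * Q + P * PsiDO.lie D Q := by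
  obtain ⟨M, hM⟩ := P.exists_bound
  obtain ⟨N, hN⟩ := Q.exists_bound
  have hM' : ∀ i, M < i → (PsiDO.lie D P).coeff i = 0 := fun i hi => by
    rw [PsiDO.coeff_lie, hM i hi, map_zero]
  have hN' : ∀ i, N < i → (PsiDO.lie D Q).coeff i = 0 := fun i hi => by
    rw [PsiDO.coeff_lie, hN i hi, map_zero]
  ext l : 1
  have h0 := PsiDO.coeff_mul_eq_sum (dxR m n A) hM hN l
  have h1 := PsiDO.coeff_mul_eq_sum (dxR m n A) hM' hN l
  have h2 := PsiDO.coeff_mul_eq_sum (dxR m n A) hM hN' l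
  change (P * Q).coeff l = _ at h0
  change (PsiDO.lie D P * Q).coeff l = _ at h1
  change (P * PsiDO.lie D Q).coeff l = _ at h2
  rw [PsiDO.coeff_lie, PsiDO.coeff_add, h0, h1, h2, map_sum, ← Finset.sum_add_distrib]
  refine Finset.sum_congr rfl fun p _ => ?_
  simp only [PsiDO.mulTerm, PsiDO.coeff_lie]
  rw [map_zsmul, Derivation.leibniz, ← smul_add]
  change _ • (_ * extDer D.1 ((dx A)^[p.2] _) + _) = _ • (_ + _ * (dx A)^[p.2] _)
  rw [extDer_comm_iterate_dx, add_comm, smul_eq_mul, mul_comm]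

theorem PsiDO.lie_one (D : VectorField m n) : PsiDO.lie D (1 : PsiDO (DPoly m n A)) = 0 := by
  have h := PsiDO.lie_mul (A := A) D 1 1
  simpa using h

theorem act_trIntRes (tr : TraceForm A) (D : VectorField m n) (P : PsiDO (DPoly m n A)) :
    D.act (trIntRes tr P) = trIntRes tr (PsiDO.lie D P) := by
  have h : mapCoeff tr.form (PsiDO.lie D P).res = D.1 (mapCoeff tr.form P.res) :=
    mapCoeff_extDer D.1 tr.form P.res
  rw [trIntRes, trIntRes, h]
  rfl

/-! ### Vector fields and their characteristics -/

variable (e : Module.Basis (Fin n) ℝ A)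

theorem char_evol (a : Idx m → DPoly m n A) (i : Idx m) : (evol e a).char e i = a i := by
  rw [VectorField.char]
  simp only [evol, mkDerivation_X, Function.iterate_zero, id_eq]
  exact sum_tensor_coord e (a i)

theorem char_add (D E : VectorField m n) : (D + E).char e = D.char e + E.char e := by
  ext1 i
  simp only [VectorField.char, Pi.add_apply, ← Finset.sum_add_distrib, ← tensor_add]
  rfl

theorem char_smul (c : ℝ) (D : VectorField m n) : (c • D).char e = c • D.char e := by
  ext1 i
  simp only [VectorField.char, Pi.smul_apply, Finset.smul_sum, ← tensor_smul]
  rfl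

theorem char_injective : Function.Injective fun D : VectorField m n => D.char e := fun D E h => by
  rw [← evol_char e D, ← evol_char e E]
  exact congrArg _ h

theorem char_lie (D E : VectorField m n) (i : Idx m) :
    (⁅D, E⁆ : VectorField m n).char e i = extDer D.1 (E.char e i) - extDer E.1 (D.char e i) := by
  simp only [VectorField.char, map_sum, extDer_tensor, ← Finset.sum_sub_distrib, ← tensor_sub]
  rfl

theorem extDer_fieldV (D : VectorField m n) (i : Idx m) :
    extDer D.1 (fieldV e i) = D.char e i := by
  have : fieldV e i = ∑ q, tensor (X (i, q, 0)) (e q) := by simp [fieldV, tensor]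
  rw [this, map_sum]
  simp only [extDer_tensor]
  rfl

theorem coeff_seqToPsiDO (a : Idx m → DPoly m n A) (i : ℤ) :
    (seqToPsiDO a).coeff i = if h : i < m then a ⟨i, h⟩ else 0 := rfl

theorem coeff_lax (i : ℤ) : (lax m e).coeff i =
    if h : i < m then fieldV e ⟨i, h⟩ else if i = m then 1 else 0 := rfl

/-- The leading coefficient 1 is constant, so only the fields V_i are differentiated. -/
theorem lie_lax (D : VectorField m n) : PsiDO.lie D (lax m e) = seqToPsiDO (D.char e) := by
  ext i : 1
  rw [PsiDO.coeff_lie, coeff_lax, coeff_seqToPsiDO]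
  split_ifs
  · exact extDer_fieldV e D _
  · exact Derivation.map_one_eq_zero _
  · exact map_zero _

theorem seqToPsiDO_char_fieldOf {P : PsiDO (DPoly m n A)}
    (hP : ∀ i : ℤ, (m : ℤ) ≤ i → P.coeff i = 0) :
    seqToPsiDO ((fieldOf e P).char e) = P := by
  ext i : 1
  rw [coeff_seqToPsiDO]
  split_ifs with h
  · rw [fieldOf, char_evol]
  · rw [hP i (not_lt.mp h)]

theorem fieldOf_add (P Q : PsiDO (DPoly m n A)) :
    fieldOf e (P + Q) = fieldOf e P + fieldOf (m := m) e Q := by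
  apply char_injective e
  ext1 i
  simp only [fieldOf, char_add, Pi.add_apply, char_evol, PsiDO.coeff_add]

theorem fieldOf_smul (c : ℝ) (P : PsiDO (DPoly m n A)) :
    fieldOf e (c • P) = c • fieldOf (m := m) e P := by
  apply char_injective e
  ext1 i
  simp only [fieldOf, char_smul, Pi.smul_apply, char_evol, PsiDO.coeff_smul]

theorem lie_fieldOf (P Q : PsiDO (DPoly m n A)) : ⁅fieldOf (m := m) e P, fieldOf e Q⁆ =
    fieldOf e (PsiDO.lie (fieldOf e P) Q - PsiDO.lie (fieldOf e Q) P) := by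
  apply char_injective e
  ext1 i
  refine (char_lie e _ _ i).trans ?_
  simp only [fieldOf, char_evol, PsiDO.coeff_sub, PsiDO.coeff_lie]

/-! ### One-forms -/

theorem OneForm.toPsiDO_single (i : Idx m) (x : DPoly m n A) :
    OneForm.toPsiDO (Finsupp.single i x) = PsiDO.single (-i.1 - 1) 1 * PsiDO.single 0 x := by
  rw [OneForm.toPsiDO, Finsupp.sum_single_index]
  · rfl
  · have : PsiDO.single 0 (0 : DPoly m n A) = 0 := by ext i : 1; simp [PsiDO.coeff_single]
    rw [this]
    exact mul_zero _

theorem PsiDO.single_add {R : Type*} [CommRing R] [Algebra ℝ R] (i : ℤ) (a b : R) :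
    PsiDO.single i (a + b) = PsiDO.single i a + PsiDO.single i b := by
  ext j
  simp only [PsiDO.coeff_single, PsiDO.coeff_add]
  split_ifs <;> simp

theorem PsiDO.single_smul {R : Type*} [CommRing R] [Algebra ℝ R] (c : ℝ) (i : ℤ) (a : R) :
    PsiDO.single i (c • a) = c • PsiDO.single i a := by
  ext j
  simp only [PsiDO.coeff_single, PsiDO.coeff_smul]
  split_ifs <;> simp

theorem OneForm.toPsiDO_add (Y Z : OneForm m n A) :
    OneForm.toPsiDO (Y + Z) = Y.toPsiDO + Z.toPsiDO := by
  rw [OneForm.toPsiDO, Finsupp.sum_add_index']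
  · rfl
  · intro i
    refine (OneForm.toPsiDO_single i (0 : DPoly m n A)).symm.trans ?_
    rw [Finsupp.single_zero]
    rfl
  · intro i x y
    rw [PsiDO.single_add]
    exact mul_add (PsiDO.single (-i.1 - 1) 1) (PsiDO.single 0 x) (PsiDO.single 0 y)

theorem OneForm.toPsiDO_smul (c : ℝ) (Y : OneForm m n A) :
    OneForm.toPsiDO (c • Y) = c • Y.toPsiDO := by
  induction Y using Finsupp.induction_linear with
  | zero =>
    rw [smul_zero]
    exact (smul_zero c).symm
  | add f g hf hg => rw [smul_add, OneForm.toPsiDO_add, hf, hg, OneForm.toPsiDO_add, smul_add]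
  | single i x =>
    rw [Finsupp.smul_single, OneForm.toPsiDO_single, OneForm.toPsiDO_single, PsiDO.single_smul,
      mul_smul_comm]

theorem OneForm.toPsiDO_eq_sum (Y : OneForm m n A) :
    Y.toPsiDO = Y.sum fun i x => PsiDO.single (-i.1 - 1) 1 * PsiDO.single 0 x := rfl

/-- This is the point of writing one-forms with ∂ on the left: the pairing with ∂^{−i−1}x reads off
the i-th coefficient without derivatives. -/
theorem PsiDO.res_mul_monomial (P : PsiDO (DPoly m n A)) (i : ℤ) (x : DPoly m n A) :
    (P * (PsiDO.single (-i - 1) 1 * PsiDO.single 0 x)).res = P.coeff i * x := by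
  rw [← mul_assoc]
  have h := PsiDO.res_mul_single_zero (dxR m n A) (P * PsiDO.single (-i - 1) 1) x
  have h2 := PsiDO.coeff_mul_single_one (dxR m n A) P (-i - 1) (-1)
  rw [show -1 - (-i - 1) = i by ring] at h2
  refine Eq.trans h ?_
  exact congrArg (· * x) h2

theorem PsiDO.res_mul_toPsiDO (P : PsiDO (DPoly m n A)) (Y : OneForm m n A) :
    (P * Y.toPsiDO).res = Y.sum fun i x => P.coeff i.1 * x := by
  rw [OneForm.toPsiDO_eq_sum, Finsupp.mul_sum, Finsupp.sum, PsiDO.res, PsiDO.coeff_sum]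
  exact Finset.sum_congr rfl fun i _ => PsiDO.res_mul_monomial P i.1 (Y i)

theorem trIntRes_mul_toPsiDO (tr : TraceForm A) (P : PsiDO (DPoly m n A)) (Y : OneForm m n A) :
    trIntRes tr (P * Y.toPsiDO) =
      Y.sum fun i x => integral (mapCoeff tr.form (P.coeff i.1 * x)) := by
  rw [trIntRes, PsiDO.res_mul_toPsiDO, Finsupp.sum, map_sum, map_sum]
  rfl

/-! ### Operators with coefficients in a differential subalgebra -/

/-- All the coefficients lie in `S`. -/
def PsiDO.CoeffMem (S : Subalgebra A (DPoly m n A)) (P : PsiDO (DPoly m n A)) : Prop :=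
  ∀ i, P.coeff i ∈ S

namespace PsiDO.CoeffMem

variable {S : Subalgebra A (DPoly m n A)} {P Q : PsiDO (DPoly m n A)}

theorem add (hP : P.CoeffMem S) (hQ : Q.CoeffMem S) : (P + Q).CoeffMem S :=
  fun i => S.add_mem (hP i) (hQ i)

theorem sub (hP : P.CoeffMem S) (hQ : Q.CoeffMem S) : (P - Q).CoeffMem S :=
  fun i => S.sub_mem (hP i) (hQ i)

theorem pos (hP : P.CoeffMem S) : P.pos.CoeffMem S := fun i => by
  rw [PsiDO.coeff_pos]
  split_ifs
  exacts [hP i, S.zero_mem]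

theorem smul (c : ℝ) (hP : P.CoeffMem S) : (c • P).CoeffMem S := fun i => by
  rw [PsiDO.coeff_smul, ← algebraMap_smul A c]
  exact S.smul_mem (hP i) _

theorem single (i : ℤ) {a : DPoly m n A} (ha : a ∈ S) : (PsiDO.single i a).CoeffMem S := fun j => by
  rw [PsiDO.coeff_single]
  split_ifs
  exacts [ha, S.zero_mem]

theorem one : (1 : PsiDO (DPoly m n A)).CoeffMem S := single 0 S.one_mem

theorem iterate_dx_mem (hS : ∀ x ∈ S, dx A x ∈ S) (k : ℕ) {x : DPoly m n A} (hx : x ∈ S) :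
    (dx A)^[k] x ∈ S := by
  induction k with
  | zero => exact hx
  | succ k ih =>
    rw [Function.iterate_succ_apply']
    exact hS _ ih

theorem mul (hS : ∀ x ∈ S, dx A x ∈ S) (hP : P.CoeffMem S) (hQ : Q.CoeffMem S) :
    (P * Q).CoeffMem S := fun l => by
  obtain ⟨s, hs⟩ := PsiDO.coeff_mul_eq P Q l
  rw [hs]
  exact S.sum_mem fun p _ => zsmul_mem (S.mul_mem (hP _) (iterate_dx_mem hS _ (hQ _))) _

theorem toPsiDO (hS : ∀ x ∈ S, dx A x ∈ S) {Y : OneForm m n A} (hY : Y ∈ Omega S) :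
    Y.toPsiDO.CoeffMem S := fun l => by
  rw [OneForm.toPsiDO_eq_sum, Finsupp.sum, PsiDO.coeff_sum]
  exact S.sum_mem fun i _ => mul hS (single _ S.one_mem) (single _ (hY i)) l

end PsiDO.CoeffMem

/-- Modulo operators of order less than `-m`, every operator is a one-form. -/
theorem exists_oneForm {S : Subalgebra A (DPoly m n A)} (hS : ∀ x ∈ S, dx A x ∈ S)
    (P : PsiDO (DPoly m n A)) (hP : P.CoeffMem S) :
    ∃ Y ∈ Omega S, ∀ i : ℤ, -(m : ℤ) ≤ i → (P - Y.toPsiDO).coeff i = 0 := by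
  have key : ∀ (k : ℕ) (P : PsiDO (DPoly m n A)), P.CoeffMem S →
      (∀ i : ℤ, -(m : ℤ) + k ≤ i → P.coeff i = 0) →
      ∃ Y ∈ Omega S, ∀ i : ℤ, -(m : ℤ) ≤ i → (P - Y.toPsiDO).coeff i = 0 := by
    intro k
    induction k with
    | zero =>
      intro P _ h
      refine ⟨0, (Omega S).zero_mem, fun i hi => ?_⟩
      have : OneForm.toPsiDO (0 : OneForm m n A) = 0 := rfl
      rw [this, sub_zero]
      exact h i (by simpa using hi)
    | succ k ih =>
      intro P hP h
      -- The leading power is −m + k = −j − 1, so subtracting this monomial one-form lowers the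
      -- order by one.
      let j : Idx m := ⟨m - k - 1, by omega⟩
      let Y : OneForm m n A := Finsupp.single j (P.coeff (-m + k))
      have hY : Y ∈ Omega S := fun i => by
        classical
        simp only [Y, Finsupp.single_apply]
        split_ifs
        exacts [hP _, S.zero_mem]
      obtain ⟨Z, hZ, hZ'⟩ := ih (P - Y.toPsiDO) (hP.sub (.toPsiDO hS hY)) (fun i hi => by
        rw [PsiDO.coeff_sub, OneForm.toPsiDO_single, sub_eq_zero]
        rcases eq_or_lt_of_le hi with rfl | hi
        · have := PsiDO.coeff_single_mul_single (dxR m n A) (-j.1 - 1) 0 1 (P.coeff (-m + k))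
            (-m + k) 0 (by simp only [j]; push_cast; ring)
          refine Eq.trans ?_ this.symm
          simp
        · rw [h i (by push_cast; omega)]
          exact (PsiDO.coeff_single_mul_single_eq_zero (dxR m n A) (-j.1 - 1) 0 1 _ i
            (by simp only [j]; omega)).symm)
      refine ⟨Y + Z, (Omega S).add_mem hY hZ, fun i hi => ?_⟩
      rw [OneForm.toPsiDO_add, ← sub_sub]
      exact hZ' i hi
  obtain ⟨N, hN⟩ := P.exists_bound
  exact key (N + m + 1).toNat P hP fun i hi => hN i (by omega)

end Poly

end FrobKP

namespace FrobKP

open MvPolynomial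

section Poly

variable {m n : ℕ} {A : Type*} [CommRing A] [Algebra ℝ A]

/-! ### Variational derivatives -/

theorem integral_dx (f : DPoly m n ℝ) : integral (dx ℝ f) = 0 :=
  (Submodule.Quotient.mk_eq_zero _).mpr ⟨f, rfl⟩

theorem integral_mul_iterate_dx (k : ℕ) (f g : DPoly m n ℝ) :
    integral (f * (dx ℝ)^[k] g) = integral (g * ((-1 : ℝ) ^ k • (dx ℝ)^[k] f)) := by
  obtain ⟨c, hc⟩ := PsiDO.exists_eq_mul_iterate_sub (dx (m := m) (n := n) ℝ) k f g
  have h := integral_dx c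
  rw [hc, map_sub, sub_eq_zero] at h
  rw [h, mul_smul_comm, Algebra.smul_def, map_pow, map_neg, map_one]

theorem derivation_eq_sum (D : Derivation ℝ (DPoly m n ℝ) (DPoly m n ℝ)) (f : DPoly m n ℝ)
    (s : Finset (Jet m n)) (hs : f.vars ⊆ s) : D f = ∑ p ∈ s, pderiv p f * D (X p) := by
  classical
  have h : ∀ g, (∑ p ∈ s, D (X p) • pderiv p) g = ∑ p ∈ s, pderiv p g * D (X p) := fun g => by
    rw [← Derivation.coeFnAddMonoidHom_apply, map_sum, Finset.sum_apply]
    exact Finset.sum_congr rfl fun p _ => mul_comm _ _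
  rw [← h]
  refine derivation_eq_of_forall_mem_vars fun p hp => ?_
  rw [h, Finset.sum_eq_single p]
  · simp
  · intro q _ hq
    rw [pderiv_X_of_ne hq.symm, zero_mul]
  · intro hp'
    exact absurd (hs hp) hp'

theorem varDeriv_eq_sum (f : DPoly m n ℝ) (N : ℕ) (hN : ∀ p ∈ f.vars, p.2.2 < N) (i : Idx m)
    (q : Fin n) : varDeriv f i q =
      ∑ j ∈ Finset.range N, (-1 : ℝ) ^ j • (dx ℝ)^[j] (pderiv (i, q, j) f) := by
  refine finsum_eq_sum_of_support_subset _ fun j hj => ?_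
  rw [Finset.mem_coe, Finset.mem_range]
  by_contra h
  have : (i, q, j) ∉ f.vars := fun hv => h (hN _ hv)
  apply hj
  beta_reduce
  rw [pderiv_eq_zero_of_notMem_vars this, Function.iterate_fixed (map_zero (dx ℝ)), smul_zero]

theorem exists_jet_bound (f : DPoly m n ℝ) : ∃ N : ℕ, ∀ p ∈ f.vars, p.2.2 < N :=
  ⟨f.vars.sup (fun p => p.2.2) + 1, fun _ hp =>
    Nat.lt_succ_of_le (Finset.le_sup (f := fun p : Jet m n => p.2.2) hp)⟩

theorem VectorField.apply_X (D : VectorField m n) (i : Idx m) (q : Fin n) (j : ℕ) :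
    D.1 (X (i, q, j)) = (dx ℝ)^[j] (D.1 (X (i, q, 0))) := by
  induction j with
  | zero => rfl
  | succ j ih =>
    rw [Function.iterate_succ_apply', ← ih, ← D.2]
    simp [dx, mkDerivation_X]

/-- The first variation: chain rule over the jet variables, D(v^{(j)}) = ∂^j D(v), and j
integrations by parts. -/
theorem integral_derivation (D : VectorField m n) (f : DPoly m n ℝ) :
    integral (D.1 f) = ∑ i ∈ f.vars.image Prod.fst, ∑ q,
      integral (D.1 (X (i, q, 0)) * varDeriv f i q) := by
  classical
  obtain ⟨N, hN⟩ := exists_jet_bound f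
  rw [derivation_eq_sum D.1 f (f.vars.image Prod.fst ×ˢ Finset.univ ×ˢ Finset.range N),
    Finset.sum_product, map_sum]
  · refine Finset.sum_congr rfl fun i _ => ?_
    rw [Finset.sum_product, map_sum]
    refine Finset.sum_congr rfl fun q _ => ?_
    rw [varDeriv_eq_sum f N hN, Finset.mul_sum, map_sum, map_sum]
    refine Finset.sum_congr rfl fun j _ => ?_
    rw [VectorField.apply_X, integral_mul_iterate_dx]
  · intro p hp
    simp only [Finset.mem_product, Finset.mem_univ, Finset.mem_range, true_and]
    exact ⟨Finset.mem_image_of_mem _ hp, hN p hp⟩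

variable (tr : TraceForm A) (e : Module.Basis (Fin n) ℝ A)

theorem mapCoeff_char (D : VectorField m n) (i : Idx m) (q : Fin n) :
    mapCoeff (e.coord q) (D.char e i) = D.1 (X (i, q, 0)) := by
  simp [VectorField.char, map_sum, mapCoeff_tensor, Finsupp.single_apply]

theorem tensor_mul_tensor (f g : DPoly m n ℝ) (a b : A) :
    tensor f a * tensor g b = tensor (f * g) (a * b) := by
  simp only [tensor, map_mul]
  ring

theorem mapCoeff_mul_tensor (φ : A →ₗ[ℝ] ℝ) (F : DPoly m n A) (g : DPoly m n ℝ) (b : A) :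
    mapCoeff φ (F * tensor g b) = mapCoeff (φ ∘ₗ LinearMap.mulRight ℝ b) F * g := by
  induction F using MvPolynomial.induction_on' with
  | monomial t a =>
    rw [monomial_eq_tensor, tensor_mul_tensor, mapCoeff_tensor, mapCoeff_tensor, smul_mul_assoc]
    rfl
  | add p q hp hq => rw [add_mul, map_add, hp, hq, map_add, add_mul]

theorem mapCoeff_C_mul (φ : A →ₗ[ℝ] ℝ) (F : DPoly m n A) (b : A) :
    mapCoeff φ (C b * F) = mapCoeff (φ ∘ₗ LinearMap.mulLeft ℝ b) F := by
  ext t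
  rw [coeff_mapCoeff, coeff_C_mul, coeff_mapCoeff]
  rfl

theorem form_comp_mulRight_dualBasis (q : Fin n) :
    tr.form ∘ₗ LinearMap.mulRight ℝ (tr.bilin.dualBasis tr.bilin_nondegenerate e q) =
      e.coord q := by
  refine e.ext fun j => ?_
  have h := LinearMap.BilinForm.apply_dualBasis_left tr.bilin_nondegenerate e q j
  rw [LinearMap.comp_apply, LinearMap.mulRight_apply, mul_comm]
  refine Eq.trans h ?_
  simp [Finsupp.single_apply]

theorem form_comp_mulLeft (q : Fin n) : tr.form ∘ₗ LinearMap.mulLeft ℝ (e q) =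
    (tr.bilin.dualBasis tr.bilin_nondegenerate e).coord q := by
  refine LinearMap.ext fun x => ?_
  rw [Module.Basis.coord_apply, LinearMap.BilinForm.dualBasis_repr_apply, LinearMap.comp_apply,
    LinearMap.mulLeft_apply, mul_comm]
  rfl

theorem mapCoeff_mul_dual (F : DPoly m n A) (g : DPoly m n ℝ) (q : Fin n) :
    mapCoeff tr.form (F * tensor g (tr.bilin.dualBasis tr.bilin_nondegenerate e q)) =
      mapCoeff (e.coord q) F * g := by
  rw [mapCoeff_mul_tensor, form_comp_mulRight_dualBasis]

theorem sum_tensor_dual (F : DPoly m n A) :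
    ∑ q, tensor (mapCoeff tr.form (C (e q) * F))
      (tr.bilin.dualBasis tr.bilin_nondegenerate e q) = F := by
  conv_rhs => rw [← sum_tensor_coord (tr.bilin.dualBasis tr.bilin_nondegenerate e) F]
  refine Finset.sum_congr rfl fun q _ => ?_
  rw [mapCoeff_C_mul, form_comp_mulLeft]

theorem varDerivL_apply (f : DPoly m n ℝ) (i : Idx m) :
    varDerivL tr e f i = varDerivV tr e f i := rfl

/-- The variational formula: `δf/δ𝓛` represents the differential of `∫ f dx`. -/
theorem act_integral (D : VectorField m n) (f : DPoly m n ℝ) :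
    D.act (integral f) = pairing tr e D (varDerivL tr e f) := by
  have h : pairing tr e D (varDerivL tr e f) = (varDerivL tr e f).sum fun i x =>
      integral (mapCoeff tr.form ((seqToPsiDO (D.char e)).coeff i.1 * x)) :=
    trIntRes_mul_toPsiDO tr _ _
  rw [h, Finsupp.sum_of_support_subset (varDerivL tr e f) (s := f.vars.image Prod.fst)
    Finsupp.support_onFinset_subset]
  · refine (integral_derivation D f).trans (Finset.sum_congr rfl fun i _ => ?_)
    rw [coeff_seqToPsiDO, dif_pos i.2, varDerivL_apply, varDerivV, Finset.mul_sum, map_sum, map_sum]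
    refine Finset.sum_congr rfl fun q _ => ?_
    rw [mapCoeff_mul_dual, mapCoeff_char]
  · intro i _
    rw [mul_zero, map_zero, map_zero]

/-! ### Admissible classes of coefficients -/

/-- The properties of the class `S` that are used: it is a differential subalgebra containing the
fields, stable under the vector fields with characteristics in `S`, and contains the variational
derivatives of its functionals. -/
structure IsAdmissible (S : Subalgebra A (DPoly m n A)) : Prop where
  dx_mem : ∀ F ∈ S, dx A F ∈ S
  fieldV_mem : ∀ i, fieldV e i ∈ S
  extDer_mem : ∀ D : VectorField m n, (∀ i, D.char e i ∈ S) → ∀ F ∈ S, extDer D.1 F ∈ S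
  varDerivV_mem : ∀ F ∈ S, ∀ i, varDerivV tr e (mapCoeff tr.form F) i ∈ S

theorem isAdmissible_top : IsAdmissible tr e (⊤ : Subalgebra A (DPoly m n A)) :=
  ⟨fun _ _ => trivial, fun _ => trivial, fun _ _ _ _ => trivial, fun _ _ _ => trivial⟩

theorem derivation_mem_adjoin {R B : Type*} [CommRing R] [CommRing B] [Algebra R B]
    (D : Derivation R B B) (s : Set B) (h : ∀ x ∈ s, D x ∈ Algebra.adjoin R s) :
    ∀ x ∈ Algebra.adjoin R s, D x ∈ Algebra.adjoin R s := by
  intro x hx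
  induction hx using Algebra.adjoin_induction with
  | mem x hx => exact h x hx
  | algebraMap r => rw [Derivation.map_algebraMap]; exact Subalgebra.zero_mem _
  | add x y _ _ hx hy => rw [map_add]; exact Subalgebra.add_mem _ hx hy
  | mul x y hx' hy' hx hy =>
    rw [Derivation.leibniz]
    exact Subalgebra.add_mem _ (Subalgebra.mul_mem _ hx' hy) (Subalgebra.mul_mem _ hy' hx)

theorem dx_C_mul (a : A) (F : DPoly m n A) : dx A (C a * F) = C a * dx A F := by
  rw [C_mul', Derivation.map_smul, C_mul']

theorem iterate_dx_C_mul (k : ℕ) (a : A) (F : DPoly m n A) :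
    (dx A)^[k] (C a * F) = C a * (dx A)^[k] F := by
  induction k with
  | zero => rfl
  | succ k ih =>
    rw [Function.iterate_succ_apply', ih, dx_C_mul, Function.iterate_succ_apply']

theorem iterate_dx_fieldV (i : Idx m) (k : ℕ) :
    (dx A)^[k] (fieldV e i) = ∑ q, C (e q) * X (i, q, k) := by
  induction k with
  | zero => rfl
  | succ k ih =>
    rw [Function.iterate_succ_apply', ih, map_sum]
    refine Finset.sum_congr rfl fun q _ => ?_
    rw [dx_C_mul, dx, mkDerivation_X]

theorem extDer_pderiv (p : Jet m n) : extDer (pderiv p) = pderiv (R := A) p := by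
  classical
  apply derivation_ext
  intro q
  rw [extDer, mkDerivation_X, pderiv_X, pderiv_X]
  by_cases h : q = p
  · subst h; simp
  · simp [h]

theorem mapCoeff_pderiv (φ : A →ₗ[ℝ] ℝ) (p : Jet m n) (F : DPoly m n A) :
    mapCoeff φ (pderiv p F) = pderiv p (mapCoeff φ F) := by
  rw [← extDer_pderiv, mapCoeff_extDer]

/-- A differential polynomial in the `V i` has a partial derivative with respect to each
`∂ʲ V i`. -/
theorem exists_pderiv_eq {F : DPoly m n A} (hF : F ∈ diffPolyV m e) (i : Idx m) (j : ℕ) :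
    ∃ G ∈ diffPolyV m e, ∀ q, pderiv (i, q, j) F = C (e q) * G := by
  classical
  induction hF using Algebra.adjoin_induction with
  | mem x hx =>
    obtain ⟨i', k, rfl⟩ := hx
    refine ⟨if i' = i ∧ k = j then 1 else 0, ?_, fun q => ?_⟩
    · split_ifs
      exacts [Subalgebra.one_mem _, Subalgebra.zero_mem _]
    · rw [iterate_dx_fieldV, map_sum, Finset.sum_eq_single q]
      · rw [pderiv_C_mul, pderiv_X, Pi.single_apply]
        simp [Prod.ext_iff]
      · intro q' _ hq'
        rw [pderiv_C_mul, pderiv_X_of_ne (by simp [hq']), mul_zero]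
      · simp
  | algebraMap r =>
    exact ⟨0, Subalgebra.zero_mem _, fun q => by rw [Derivation.map_algebraMap, mul_zero]⟩
  | add x y _ _ hx hy =>
    obtain ⟨G, hG, h⟩ := hx
    obtain ⟨G', hG', h'⟩ := hy
    exact ⟨G + G', Subalgebra.add_mem _ hG hG', fun q => by rw [map_add, h, h', mul_add]⟩
  | mul x y hx' hy' hx hy =>
    obtain ⟨G, hG, h⟩ := hx
    obtain ⟨G', hG', h'⟩ := hy
    refine ⟨x * G' + y * G, Subalgebra.add_mem _ (Subalgebra.mul_mem _ hx' hG')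
      (Subalgebra.mul_mem _ hy' hG), fun q => ?_⟩
    rw [Derivation.leibniz, h, h', smul_eq_mul, smul_eq_mul]
    ring

/-- Closure under derivations is checked on generators. For variational derivatives,
∂F/∂v_{[i]q}^{(j)} = e_q G_j with G_j independent of q, so the dual basis assembles δf/δV_i into Σ_j
(−∂)^j G_j, which stays in the class. -/
theorem isAdmissible_diffPolyV : IsAdmissible tr e (diffPolyV m e) := by
  have hgen : ∀ (i : Idx m) (j : ℕ), (dx A)^[j] (fieldV e i) ∈ diffPolyV m e := fun i j =>
    Algebra.subset_adjoin ⟨i, j, rfl⟩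
  have hdx : ∀ F ∈ diffPolyV m e, dx A F ∈ diffPolyV m e := by
    refine derivation_mem_adjoin (dx A) _ ?_
    rintro _ ⟨i, j, rfl⟩
    have h := hgen i (j + 1)
    rwa [Function.iterate_succ_apply'] at h
  refine ⟨hdx, fun i => hgen i 0, fun D hD => derivation_mem_adjoin _ _ ?_, fun F hF i => ?_⟩
  · rintro _ ⟨i, j, rfl⟩
    rw [extDer_comm_iterate_dx, extDer_fieldV]
    exact PsiDO.CoeffMem.iterate_dx_mem hdx j (hD i)
  · choose G hG hG' using exists_pderiv_eq e hF i
    obtain ⟨N, hN⟩ := exists_jet_bound (mapCoeff tr.form F)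
    have h : varDerivV tr e (mapCoeff tr.form F) i =
        ∑ j ∈ Finset.range N, (-1 : ℝ) ^ j • (dx A)^[j] (G j) := by
      rw [← sum_tensor_dual tr e (∑ j ∈ Finset.range N, (-1 : ℝ) ^ j • (dx A)^[j] (G j)), varDerivV]
      refine Finset.sum_congr rfl fun q _ => ?_
      rw [varDeriv_eq_sum _ N hN, Finset.mul_sum, map_sum]
      congr 1
      refine Finset.sum_congr rfl fun j _ => ?_
      rw [mul_smul_comm, map_smul, ← mapCoeff_pderiv, hG', ← mapCoeff_iterate_dx, iterate_dx_C_mul]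
    rw [h]
    refine Subalgebra.sum_mem _ fun j _ => ?_
    rw [← algebraMap_smul A]
    exact Subalgebra.smul_mem _ (PsiDO.CoeffMem.iterate_dx_mem hdx j (hG j)) _

variable {tr e} {S : Subalgebra A (DPoly m n A)}

theorem IsAdmissible.varDerivL_mem (hS : IsAdmissible tr e S) {F : DPoly m n A} (hF : F ∈ S) :
    varDerivL tr e (mapCoeff tr.form F) ∈ Omega S := fun i => hS.varDerivV_mem F hF i

theorem IsAdmissible.lax_mem (hS : IsAdmissible tr e S) : (lax m e).CoeffMem S := fun i => by
  rw [coeff_lax]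
  split_ifs
  exacts [hS.fieldV_mem _, S.one_mem, S.zero_mem]

theorem IsAdmissible.lie_mem (hS : IsAdmissible tr e S) {P Q : PsiDO (DPoly m n A)}
    (hP : P.CoeffMem S) (hQ : Q.CoeffMem S) : (PsiDO.lie (fieldOf e P) Q).CoeffMem S := fun i =>
  hS.extDer_mem _ (fun j => by rw [fieldOf, char_evol]; exact hP j) _ (hQ i)

end Poly

end FrobKP

namespace FrobKP

open MvPolynomial

section Poly

variable {m n : ℕ} {A : Type*} [CommRing A] [Algebra ℝ A] {tr : TraceForm A}
  {e : Module.Basis (Fin n) ℝ A} {S : Subalgebra A (DPoly m n A)}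

/-! ### A criterion for Hamiltonian mappings -/

theorem seqToPsiDO_add (a b : Idx m → DPoly m n A) :
    seqToPsiDO (a + b) = seqToPsiDO a + seqToPsiDO b := by
  ext i : 1
  simp only [PsiDO.coeff_add, coeff_seqToPsiDO]
  split_ifs <;> simp

theorem seqToPsiDO_smul (c : ℝ) (a : Idx m → DPoly m n A) :
    seqToPsiDO (c • a) = c • seqToPsiDO a := by
  ext i : 1
  simp only [PsiDO.coeff_smul, coeff_seqToPsiDO]
  split_ifs <;> simp

theorem pairing_eq (D : VectorField m n) (Y : OneForm m n A) :
    pairing tr e D Y = trIntResHom tr (seqToPsiDO (D.char e) * Y.toPsiDO) := rfl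

theorem pairing_add_left (D E : VectorField m n) (Y : OneForm m n A) :
    pairing tr e (D + E) Y = pairing tr e D Y + pairing tr e E Y := by
  simp only [pairing_eq, char_add, seqToPsiDO_add, add_mul, map_add]

theorem pairing_smul_left (c : ℝ) (D : VectorField m n) (Y : OneForm m n A) :
    pairing tr e (c • D) Y = c • pairing tr e D Y := by
  simp only [pairing_eq, char_smul, seqToPsiDO_smul, smul_mul_assoc, map_smul]

theorem pairing_fieldOf {P : PsiDO (DPoly m n A)} (hP : ∀ i : ℤ, (m : ℤ) ≤ i → P.coeff i = 0)
    (Y : OneForm m n A) : pairing tr e (fieldOf e P) Y = trIntRes tr (P * Y.toPsiDO) := by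
  rw [pairing_eq, seqToPsiDO_char_fieldOf e hP, trIntResHom_apply]

/-- A criterion for `X ↦ ∂_{H X}` to be Hamiltonian: `H` is the restriction of a skew linear mapping
of operators, with derivative `dH`, for which the Schouten bracket `[H, H]` vanishes. -/
theorem isHamiltonianMap_of (hS : IsAdmissible tr e S)
    (H : PsiDO (DPoly m n A) →ₗ[ℝ] PsiDO (DPoly m n A))
    (dH B : PsiDO (DPoly m n A) → PsiDO (DPoly m n A) → PsiDO (DPoly m n A))
    (hord : ∀ P, ∀ i : ℤ, (m : ℤ) ≤ i → (H P).coeff i = 0)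
    (hlow : ∀ P : PsiDO (DPoly m n A), (∀ i : ℤ, -(m : ℤ) ≤ i → P.coeff i = 0) → H P = 0)
    (hmem : ∀ P : PsiDO (DPoly m n A), P.CoeffMem S → (H P).CoeffMem S)
    (hBmem : ∀ P Q : PsiDO (DPoly m n A), P.CoeffMem S → Q.CoeffMem S → (B P Q).CoeffMem S)
    (hskew : ∀ P Q, trIntRes tr (H P * Q) = -trIntRes tr (H Q * P))
    (hderiv : ∀ (D : VectorField m n) P,
      PsiDO.lie D (H P) = dH (PsiDO.lie D (lax m e)) P + H (PsiDO.lie D P))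
    (hB : ∀ P Q, dH (H P) Q - dH (H Q) P = H (B P Q))
    (hcyc : ∀ P Q R, trIntRes tr (dH (H Q) P * R) + trIntRes tr (dH (H R) Q * P)
      + trIntRes tr (dH (H P) R * Q) = 0) :
    IsHamiltonianMap tr e S fun X => H X.toPsiDO := by
  have hdx := hS.dx_mem
  have hder : ∀ P Q, PsiDO.lie (fieldOf e (H P)) (H Q) =
      dH (H P) Q + H (PsiDO.lie (fieldOf e (H P)) Q) := fun P Q => by
    rw [hderiv, lie_lax, seqToPsiDO_char_fieldOf e (hord P)]
  have hsk : ∀ X Y : OneForm m n A, pairing tr e (fieldOf e (H X.toPsiDO)) Y =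
      -pairing tr e (fieldOf e (H Y.toPsiDO)) X := fun X Y => by
    rw [pairing_fieldOf (hord _), pairing_fieldOf (hord _), hskew]
  have hlin : IsLinearMap ℝ fun X : Omega S => fieldOf e (H X.1.toPsiDO) :=
    ⟨fun X Y => by
      rw [← fieldOf_add, ← map_add, ← OneForm.toPsiDO_add]
      rfl,
    fun c X => by
      rw [← fieldOf_smul, ← map_smul, ← OneForm.toPsiDO_smul]
      rfl⟩
  refine ⟨fun X _ => hord _, fun X hX => hmem _ (.toPsiDO hdx hX), hlin,
    fun X _ Y _ => hsk X Y, ?_⟩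
  let 𝔥 : LieSubalgebra ℝ (VectorField m n) :=
    { LinearMap.range (IsLinearMap.mk' _ hlin) with
      lie_mem' := by
        rintro _ _ ⟨X, rfl⟩ ⟨Y, rfl⟩
        have hX := PsiDO.CoeffMem.toPsiDO hdx X.2
        have hY := PsiDO.CoeffMem.toPsiDO hdx Y.2
        -- The operator that generates the commutator may have an infinite tail, whereas one-forms
        -- are finite sums; `hlow` allows it to be truncated below ∂^{−m}.
        obtain ⟨Z, hZ, hZ'⟩ := exists_oneForm hdx
          (B X.1.toPsiDO Y.1.toPsiDO + PsiDO.lie (fieldOf e (H X.1.toPsiDO)) Y.1.toPsiDO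
            - PsiDO.lie (fieldOf e (H Y.1.toPsiDO)) X.1.toPsiDO)
          (((hBmem _ _ hX hY).add (hS.lie_mem (hmem _ hX) hY)).sub (hS.lie_mem (hmem _ hY) hX))
        refine ⟨⟨Z, hZ⟩, ?_⟩
        change fieldOf e (H Z.toPsiDO) =
          ⁅fieldOf e (H X.1.toPsiDO), fieldOf e (H Y.1.toPsiDO)⁆
        have h := hlow _ hZ'
        rw [map_sub, sub_eq_zero] at h
        rw [lie_fieldOf, hder, hder, ← h, map_sub, map_add, ← hB]
        congr 1
        abel }
  have h𝔥 : (𝔥 : Set (VectorField m n)) =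
      Set.range (fun X : Omega S => fieldOf e (H X.1.toPsiDO)) := rfl
  have hrep : ∀ a : 𝔥, ∃ X : Omega S, fieldOf e (H X.1.toPsiDO) = a := fun a => a.2
  choose r hr using hrep
  have hωs : ∀ a b : 𝔥, pairing tr e a.1 (r b).1 = -pairing tr e b.1 (r a).1 := fun a b => by
    conv_lhs => rw [← hr a]
    conv_rhs => rw [← hr b]
    exact hsk _ _
  -- The chosen preimage of `b` does not matter: by skewness the value depends only on the field
  -- `b`. The same argument gives linearity in the second slot.
  let ω : 𝔥 →ₗ[ℝ] 𝔥 →ₗ[ℝ] Functional m n :=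
    LinearMap.mk₂ ℝ (fun a b => pairing tr e a.1 (r b).1)
      (fun a b c => pairing_add_left _ _ _) (fun c a b => pairing_smul_left _ _ _)
      (fun a b c => by
        rw [hωs, hωs a b, hωs a c, ← neg_add, ← pairing_add_left]
        rfl)
      (fun c a b => by
        rw [hωs, hωs a b, smul_neg, ← pairing_smul_left]
        rfl)
  have hω : ∀ a b : 𝔥, ω a b = pairing tr e a.1 (r b).1 := fun _ _ => rfl
  refine ⟨𝔥, h𝔥, ω, ?_, fun a b c => ?_⟩
  · intro X hX Y hY a b ha hb
    rw [hω, ← ha, hωs, hb, hsk Y, neg_neg, hr]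
  -- Under cyclic permutation the first and the last term on the right cancel, and the middle one
  -- sums to zero by `hcyc`.
  · have hact : ∀ a b c : 𝔥, a.1.act (ω b c) - ω ⁅a, b⁆ c =
        trIntRes tr (H (r b).1.toPsiDO * PsiDO.lie a.1 (r c).1.toPsiDO)
          + (trIntRes tr (dH (H (r b).1.toPsiDO) (r a).1.toPsiDO * (r c).1.toPsiDO)
          - trIntRes tr (H (r c).1.toPsiDO * PsiDO.lie b.1 (r a).1.toPsiDO)) := fun a b c => by
      have h1 : ω ⁅a, b⁆ c = trIntRes tr ((PsiDO.lie a.1 (H (r b).1.toPsiDO)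
          - PsiDO.lie b.1 (H (r a).1.toPsiDO)) * (r c).1.toPsiDO) := by
        have h2 : ((⁅a, b⁆ : 𝔥) : VectorField m n) =
            fieldOf e (PsiDO.lie a.1 (H (r b).1.toPsiDO) - PsiDO.lie b.1 (H (r a).1.toPsiDO)) := by
          rw [LieSubalgebra.coe_bracket]
          conv_lhs => rw [← hr a, ← hr b]
          rw [lie_fieldOf, hr, hr]
        rw [hω, h2, pairing_fieldOf]
        intro i hi
        rw [PsiDO.coeff_sub, PsiDO.coeff_lie, PsiDO.coeff_lie, hord _ i hi, hord _ i hi, map_zero,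
          map_zero, sub_zero]
      have h3 : ω b c = trIntRes tr (H (r b).1.toPsiDO * (r c).1.toPsiDO) := by
        rw [hω]
        conv_lhs => rw [← hr b]
        rw [pairing_fieldOf (hord _)]
      have h4 : PsiDO.lie b.1 (H (r a).1.toPsiDO) = dH (H (r b).1.toPsiDO) (r a).1.toPsiDO
          + H (PsiDO.lie b.1 (r a).1.toPsiDO) := by
        have := hder (r b).1.toPsiDO (r a).1.toPsiDO
        rwa [hr] at this
      rw [h1, h3, act_trIntRes, PsiDO.lie_mul, sub_mul, h4, add_mul]
      simp only [← trIntResHom_apply, map_add, map_sub]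
      simp only [trIntResHom_apply]
      rw [hskew (PsiDO.lie b.1 (r a).1.toPsiDO)]
      abel
    have h := hcyc (r a).1.toPsiDO (r b).1.toPsiDO (r c).1.toPsiDO
    have e1 := hact a b c
    have e2 := hact b c a
    have e3 := hact c a b
    rw [sub_eq_iff_eq_add] at e1 e2 e3
    rw [e1, e2, e3, ← h]
    abel

/-! ### From Hamiltonian mappings to Poisson brackets -/

theorem act_lie (a b : VectorField m n) (u : Functional m n) :
    (⁅a, b⁆ : VectorField m n).act u = a.act (b.act u) - b.act (a.act u) := by
  obtain ⟨f, rfl⟩ := Submodule.Quotient.mk_surjective _ u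
  rfl

/-- The bracket is {f, g} = ξ_f(g) with ξ_f = ∂_{H(δf/δ𝓛)}. It depends on g only through its
functional, and by skewness the same is true of f. -/
theorem IsHamiltonianMap.isPoissonBracket (hS : IsAdmissible tr e S)
    {H : OneForm m n A → PsiDO (DPoly m n A)} (hH : IsHamiltonianMap tr e S H) :
    IsPoissonBracket tr S (bracket tr e H) := by
  let δ : S → OneForm m n A := fun F => varDerivL tr e (mapCoeff tr.form F.1)
  have hδ : ∀ F, δ F ∈ Omega S := fun F => hS.varDerivL_mem F.2
  let ξ : S → VectorField m n := fun F => fieldOf e (H (δ F))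
  have hpair : ∀ D : VectorField m n, ∀ F : S,
      D.act ((toFunctional tr S).rangeRestrict F : Functional m n) = pairing tr e D (δ F) :=
    fun D F => act_integral tr e D _
  have hbr : ∀ F G : S, (ξ F).act ((toFunctional tr S).rangeRestrict G : Functional m n) =
      bracket tr e H (mapCoeff tr.form F.1) (mapCoeff tr.form G.1) := fun F G => by
    rw [hpair, pairing_fieldOf (hH.order_lt _ (hδ F))]
    rfl
  have hsk : ∀ F G : S, (ξ F).act ((toFunctional tr S).rangeRestrict G : Functional m n) =
      -(ξ G).act ((toFunctional tr S).rangeRestrict F : Functional m n) := fun F G => by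
    rw [hpair, hpair]
    exact hH.skew _ (hδ F) _ (hδ G)
  have hmem : ∀ F G : S, (ξ F).act ((toFunctional tr S).rangeRestrict G : Functional m n) ∈
      FunctionalSpace tr S := fun F G => by
    rw [hbr]
    refine ⟨⟨(H (δ F) * (δ G).toPsiDO).res, ?_⟩, rfl⟩
    exact PsiDO.CoeffMem.mul hS.dx_mem (hH.coeff_mem _ (hδ F)) (.toPsiDO hS.dx_mem (hδ G)) _
  choose r hr using (toFunctional tr S).surjective_rangeRestrict
  have hsk' : ∀ x y : FunctionalSpace tr S, (ξ (r x)).act (y : Functional m n) =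
      -(ξ (r y)).act (x : Functional m n) := fun x y => by
    conv_lhs => rw [← hr y]
    conv_rhs => rw [← hr x]
    exact hsk _ _
  have hmem' : ∀ x y : FunctionalSpace tr S, (ξ (r x)).act (y : Functional m n) ∈
      FunctionalSpace tr S := fun x y => by
    have h := hmem (r x) (r y)
    rwa [hr] at h
  let B : FunctionalSpace tr S →ₗ[ℝ] FunctionalSpace tr S →ₗ[ℝ] FunctionalSpace tr S :=
    LinearMap.mk₂ ℝ (fun x y => ⟨(ξ (r x)).act (y : Functional m n), hmem' x y⟩)
      (fun x x' y => Subtype.ext (by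
        change (ξ (r (x + x'))).act (y : Functional m n) =
          (ξ (r x)).act (y : Functional m n) + (ξ (r x')).act (y : Functional m n)
        rw [hsk', hsk' x, hsk' x', Submodule.coe_add, map_add, neg_add]))
      (fun c x y => Subtype.ext (by
        change (ξ (r (c • x))).act (y : Functional m n) = c • (ξ (r x)).act (y : Functional m n)
        rw [hsk', hsk' x, Submodule.coe_smul, map_smul, smul_neg]))
      (fun x y y' => Subtype.ext (map_add _ _ _))
      (fun c x y => Subtype.ext (map_smul _ _ _))
  have hB : ∀ x y, (B x y : Functional m n) = (ξ (r x)).act (y : Functional m n) := fun _ _ => rfl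
  refine ⟨B, fun F G => ?_, fun x y => ?_, fun x y z => ?_⟩
  · have := hsk (r ((toFunctional tr S).rangeRestrict F)) G
    rw [hr] at this
    rw [hB, this, ← hsk, hbr]
  · exact Subtype.ext (hsk' x y)
  · apply Subtype.ext
    simp only [Submodule.coe_add, hB, Submodule.coe_zero]
    obtain ⟨𝔥, h𝔥, ω, hω, hcl⟩ := hH.closed
    have hin : ∀ x, ξ (r x) ∈ 𝔥 := fun x => by
      rw [← SetLike.mem_coe, h𝔥]
      exact ⟨⟨δ (r x), hδ _⟩, rfl⟩
    -- This holds for every `D` in the image, hence also for commutators of the ξ; closedness then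
    -- becomes a relation between iterated derivatives only.
    have hωact : ∀ (D : 𝔥) (x), ω D ⟨ξ (r x), hin x⟩ = D.1.act (x : Functional m n) := fun D x => by
      have hD := D.2
      rw [← SetLike.mem_coe, h𝔥] at hD
      obtain ⟨W, hW⟩ := hD
      rw [hω W.1 W.2 (δ (r x)) (hδ _) D ⟨ξ (r x), hin x⟩ hW.symm rfl, ← hpair, hr]
      exact congrArg (fun E : VectorField m n => E.act (x : Functional m n)) hW
    have h := hcl ⟨ξ (r x), hin x⟩ ⟨ξ (r y), hin y⟩ ⟨ξ (r z), hin z⟩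
    simp only [hωact, LieSubalgebra.coe_bracket, act_lie] at h
    rw [hsk' x z, hsk' y x, hsk' z y] at h
    simp only [map_neg] at h
    rw [← neg_eq_zero, ← h]
    abel

theorem IsPoissonBracket.smul {β : DPoly m n ℝ → DPoly m n ℝ → Functional m n}
    (h : IsPoissonBracket tr S β) (c : ℝ) : IsPoissonBracket tr S fun f g => c • β f g := by
  obtain ⟨B, h1, h2, h3⟩ := h
  refine ⟨c • B, fun F G => ?_, fun x y => ?_, fun x y z => ?_⟩
  · exact congrArg (c • ·) (h1 F G)
  · simp only [LinearMap.smul_apply]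
    rw [h2, smul_neg]
  · simp only [LinearMap.smul_apply, map_smul, ← smul_add, h3, smul_zero]

/-! ### The two mappings -/

local notation "π₊" => PsiDO.posHom (R := DPoly m n A)

/-- The Adler mapping as a real linear map. -/
noncomputable def adlerLin (L : PsiDO (DPoly m n A)) :
    PsiDO (DPoly m n A) →ₗ[ℝ] PsiDO (DPoly m n A) where
  toFun := adlerMap π₊ L
  map_add' P Q := by
    simp only [adlerMap, mul_add, add_mul, map_add]
    abel
  map_smul' c P := by
    simp only [adlerMap, mul_smul_comm, smul_mul_assoc, PsiDO.posHom_apply, PsiDO.pos_smul,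
      smul_sub, RingHom.id_apply]

/-- The mapping `X ↦ [L₋, X₊]₋ - [L₊, X₋]₊` as a real linear map. -/
noncomputable def splitLin (L : PsiDO (DPoly m n A)) :
    PsiDO (DPoly m n A) →ₗ[ℝ] PsiDO (DPoly m n A) where
  toFun := splitMap π₊ L
  map_add' P Q := by
    simp only [splitMap_eq PsiDO.isSplitting, mul_add, add_mul, map_add]
    abel
  map_smul' c P := by
    simp only [splitMap_eq PsiDO.isSplitting, mul_smul_comm, smul_mul_assoc, PsiDO.posHom_apply,
      PsiDO.pos_smul, smul_sub, smul_add, RingHom.id_apply]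

theorem PsiDO.lie_posHom (D : VectorField m n) (P : PsiDO (DPoly m n A)) :
    PsiDO.lie D (π₊ P) = π₊ (PsiDO.lie D P) := PsiDO.lie_pos D P

theorem PsiDO.pos_eq_zero {R : Type*} [CommRing R] [Algebra ℝ R] {P : PsiDO R}
    (h : ∀ i : ℤ, -1 < i → P.coeff i = 0) : P.pos = 0 := by
  ext i
  rw [PsiDO.coeff_pos]
  split_ifs with hi
  · exact h i (by omega)
  · rfl

theorem PsiDO.coeff_negPart_of_neg_one_lt {R : Type*} [CommRing R] [Algebra ℝ R] (P : PsiDO R) :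
    ∀ i : ℤ, -1 < i → P.neg.coeff i = 0 := fun i hi => by
  rw [PsiDO.coeff_negPart, if_pos (by omega)]

theorem coeff_lax_of_lt (i : ℤ) (hi : (m : ℤ) < i) : (lax m e).coeff i = 0 := by
  rw [coeff_lax, dif_neg (by omega), if_neg (by omega)]

/-- Only the derivatives of `L` along vector fields have to agree with those of 𝓛, so 𝓛 and 𝓛 − z
are covered at once. -/
theorem isHamiltonianMap_adlerMap (hS : IsAdmissible tr e S) (L : PsiDO (DPoly m n A))
    (hL : ∀ i : ℤ, (m : ℤ) < i → L.coeff i = 0) (hLS : L.CoeffMem S)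
    (hLd : ∀ D : VectorField m n, PsiDO.lie D L = PsiDO.lie D (lax m e)) :
    IsHamiltonianMap tr e S fun X => adlerMap π₊ L X.toPsiDO := by
  have hdx := hS.dx_mem
  refine isHamiltonianMap_of hS (adlerLin L) (adlerDeriv π₊ L) (adlerBracket π₊ L) ?_ ?_ ?_ ?_
    (adlerMap_skew (isSplitTrace tr) L) ?_ (adlerDeriv_sub PsiDO.isSplitting L)
    (adlerDeriv_cyclic PsiDO.isSplitting (isSplitTrace tr) L)
  · intro P i hi
    -- The terms LPL cancel, so `pos` can be traded for `neg`: each product now has order at most m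
    -- − 1.
    have h : adlerLin L P = L * (P * L).neg - (L * P).neg * L := by
      change (L * P).pos * L - L * (P * L).pos =
        L * (P * L - (P * L).pos) - (L * P - (L * P).pos) * L
      simp only [mul_sub, sub_mul, mul_assoc]
      abel
    rw [h, PsiDO.coeff_sub,
      PsiDO.coeff_mul_of_order_le hL (PsiDO.coeff_negPart_of_neg_one_lt _) i (by omega),
      PsiDO.coeff_mul_of_order_le (PsiDO.coeff_negPart_of_neg_one_lt _) hL i (by omega), sub_zero]
  · intro P hP
    have hP' : ∀ i : ℤ, -m - 1 < i → P.coeff i = 0 := fun i hi => hP i (by omega)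
    change (L * P).pos * L - L * (P * L).pos = 0
    rw [PsiDO.pos_eq_zero fun i hi => PsiDO.coeff_mul_of_order_le hL hP' i (by omega),
      PsiDO.pos_eq_zero fun i hi => PsiDO.coeff_mul_of_order_le hP' hL i (by omega), zero_mul,
      mul_zero, sub_zero]
  · intro P hP
    exact .sub (.mul hdx (.pos (.mul hdx hLS hP)) hLS) (.mul hdx hLS (.pos (.mul hdx hP hLS)))
  · intro P Q hP hQ
    exact .sub (.add (.add (.sub (.sub (.mul hdx hQ (.pos (.mul hdx hLS hP)))
      (.mul hdx (.pos (.mul hdx hP hLS)) hQ)) (.mul hdx hP (.pos (.mul hdx hLS hQ))))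
      (.mul hdx (.pos (.mul hdx hQ hLS)) hP)) (.mul hdx (.mul hdx hP hLS) hQ))
      (.mul hdx (.mul hdx hQ hLS) hP)
  · intro D P
    rw [← hLd]
    change PsiDO.lie D (adlerMap π₊ L P) =
      adlerDeriv π₊ L (PsiDO.lie D L) P + adlerMap π₊ L (PsiDO.lie D P)
    simp only [adlerDeriv, adlerMap, map_sub, PsiDO.lie_mul, PsiDO.lie_posHom, map_add, mul_add,
      add_mul]
    abel

theorem isHamiltonianMap_splitMap (hm : 0 < m) (hS : IsAdmissible tr e S) :
    IsHamiltonianMap tr e S fun X => splitMap π₊ (lax m e) X.toPsiDO := by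
  have hdx := hS.dx_mem
  have hLS := hS.lax_mem
  have hL : ∀ i : ℤ, (m : ℤ) < i → (lax m e).pos.coeff i = 0 := fun i hi => by
    rw [PsiDO.coeff_pos, coeff_lax_of_lt i hi, ite_self]
  have key : ∀ P : PsiDO (DPoly m n A), splitMap π₊ (lax m e) P =
    ((lax m e).neg * P.pos - P.pos * (lax m e).neg).neg
      - ((lax m e).pos * P.neg - P.neg * (lax m e).pos).pos := fun _ => rfl
  -- The map is linear in 𝓛, so its derivative in a direction is `splitMap` at that direction.
  refine isHamiltonianMap_of hS (splitLin (lax m e)) (splitMap π₊) (splitBracket π₊) ?_ ?_ ?_ ?_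
    (splitMap_skew (isSplitTrace tr) _) ?_ (splitMap_sub PsiDO.isSplitting _)
    (splitMap_cyclic PsiDO.isSplitting (isSplitTrace tr) _)
  · intro P i hi
    change (splitMap π₊ (lax m e) P).coeff i = 0
    rw [key, PsiDO.coeff_sub, PsiDO.coeff_negPart, if_pos (by omega), PsiDO.coeff_pos,
      if_pos (by omega), PsiDO.coeff_sub,
      PsiDO.coeff_mul_of_order_le hL (PsiDO.coeff_negPart_of_neg_one_lt _) i (by omega),
      PsiDO.coeff_mul_of_order_le (PsiDO.coeff_negPart_of_neg_one_lt _) hL i (by omega), sub_zero,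
      sub_zero]
  · intro P hP
    have hP' : ∀ i : ℤ, -m - 1 < i → P.coeff i = 0 := fun i hi => hP i (by omega)
    have h0 : P.pos = 0 := PsiDO.pos_eq_zero fun i hi => hP i (by omega)
    have h1 : P.neg = P := by rw [PsiDO.neg, h0, sub_zero]
    have h2 : PsiDO.neg (0 : PsiDO (DPoly m n A)) = 0 := by
      ext i : 1
      rw [PsiDO.coeff_negPart, PsiDO.coeff_zero, ite_self]
    change splitMap π₊ (lax m e) P = 0
    rw [key, h0, h1, mul_zero, zero_mul, sub_zero, h2, PsiDO.pos_eq_zero, sub_zero]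
    intro i hi
    rw [PsiDO.coeff_sub, PsiDO.coeff_mul_of_order_le hL hP' i (by omega),
      PsiDO.coeff_mul_of_order_le hP' hL i (by omega), sub_zero]
  · intro P hP
    change (splitMap π₊ (lax m e) P).CoeffMem S
    rw [splitMap_eq PsiDO.isSplitting]
    exact .add (.sub (.sub (.mul hdx hLS (.pos hP)) (.mul hdx (.pos hP) hLS))
      (.pos (.mul hdx hLS hP))) (.pos (.mul hdx hP hLS))
  · intro P Q hP hQ
    exact .sub (.sub (.mul hdx (.pos hP) (.pos hQ)) (.mul hdx (.pos hQ) (.pos hP)))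
      (.sub (.mul hdx (.sub hP (.pos hP)) (.sub hQ (.pos hQ)))
      (.mul hdx (.sub hQ (.pos hQ)) (.sub hP (.pos hP))))
  · intro D P
    change PsiDO.lie D (splitMap π₊ (lax m e) P) =
      splitMap π₊ (PsiDO.lie D (lax m e)) P + splitMap π₊ (lax m e) (PsiDO.lie D P)
    simp only [splitMap_eq PsiDO.isSplitting, map_sub, map_add, PsiDO.lie_mul,
      PsiDO.lie_posHom]
    abel

/-! ### Locality -/

variable (S) in
/-- The differential operators with coefficients in `S`. -/
noncomputable def diffOps : Submodule S (DPoly m n A → DPoly m n A) :=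
  Submodule.span S (Set.range fun k => (dx A)^[k])

theorem exists_coeff_of_mem_diffOps {T : DPoly m n A → DPoly m n A} (hT : T ∈ diffOps S) :
    ∃ p : ℕ →₀ DPoly m n A, (∀ k, p k ∈ S) ∧ ∀ x, T x = p.sum fun k a => a * (dx A)^[k] x := by
  obtain ⟨c, rfl⟩ := Finsupp.mem_span_range_iff_exists_finsupp.mp hT
  refine ⟨c.mapRange (fun a => a.1) rfl, fun k => ?_, fun x => ?_⟩
  · rw [Finsupp.mapRange_apply]
    exact (c k).2
  · rw [Finsupp.sum_mapRange_index fun k => zero_mul _, Finsupp.sum, Finset.sum_apply]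
    rfl

theorem mul_mem_diffOps {a : DPoly m n A} (ha : a ∈ S) {T : DPoly m n A → DPoly m n A}
    (hT : T ∈ diffOps S) : (fun x => a * T x) ∈ diffOps S :=
  (diffOps S).smul_mem ⟨a, ha⟩ hT

theorem dx_comp_mem_diffOps (hS : ∀ x ∈ S, dx A x ∈ S) {T : DPoly m n A → DPoly m n A}
    (hT : T ∈ diffOps S) : (fun x => dx A (T x)) ∈ diffOps S := by
  have hT' : T ∈ Submodule.span S (Set.range fun k => (dx A)^[k]) := hT
  clear hT
  induction hT' using Submodule.span_induction with
  | mem T hT =>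
    obtain ⟨k, rfl⟩ := hT
    refine Submodule.subset_span ⟨k + 1, ?_⟩
    funext x
    exact Function.iterate_succ_apply' _ _ _
  | zero =>
    simp only [Pi.zero_apply, map_zero]
    exact (diffOps S).zero_mem
  | add T T' _ _ h h' =>
    simp only [Pi.add_apply, map_add]
    exact (diffOps S).add_mem h h'
  | smul a T hT h =>
    have : (fun x => dx A ((a • T) x)) =
        (fun x => a.1 * dx A (T x)) + fun x => dx A a.1 * T x := by
      funext x
      change dx A (a.1 * T x) = a.1 * dx A (T x) + dx A a.1 * T x
      rw [Derivation.leibniz, smul_eq_mul, smul_eq_mul, mul_comm (T x)]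
    rw [this]
    have h1 := mul_mem_diffOps a.2 h
    have h2 := mul_mem_diffOps (hS _ a.2) (show T ∈ diffOps S from hT)
    exact (diffOps S).add_mem h1 h2

theorem iterate_dx_comp_mem_diffOps (hS : ∀ x ∈ S, dx A x ∈ S) (k : ℕ)
    {T : DPoly m n A → DPoly m n A} (hT : T ∈ diffOps S) :
    (fun x => (dx A)^[k] (T x)) ∈ diffOps S := by
  induction k with
  | zero => exact hT
  | succ k ih =>
    simp only [Function.iterate_succ_apply']
    exact dx_comp_mem_diffOps hS ih

variable (S) in
/-- A family of operators of bounded order whose coefficients depend on the parameter through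
differential operators with coefficients in `S`. -/
structure IsLocalFamily (Φ : DPoly m n A → PsiDO (DPoly m n A)) : Prop where
  bound : ∃ N : ℤ, ∀ x i, N < i → (Φ x).coeff i = 0
  mem : ∀ i, (fun x => (Φ x).coeff i) ∈ diffOps S

namespace IsLocalFamily

variable {Φ Ψ : DPoly m n A → PsiDO (DPoly m n A)}

theorem add (h : IsLocalFamily S Φ) (h' : IsLocalFamily S Ψ) :
    IsLocalFamily S fun x => Φ x + Ψ x := by
  obtain ⟨N, hN⟩ := h.bound
  obtain ⟨N', hN'⟩ := h'.bound
  refine ⟨⟨max N N', fun x i hi => ?_⟩, fun i => (diffOps S).add_mem (h.mem i) (h'.mem i)⟩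
  rw [PsiDO.coeff_add, hN x i (by omega), hN' x i (by omega), add_zero]

theorem sub (h : IsLocalFamily S Φ) (h' : IsLocalFamily S Ψ) :
    IsLocalFamily S fun x => Φ x - Ψ x := by
  obtain ⟨N, hN⟩ := h.bound
  obtain ⟨N', hN'⟩ := h'.bound
  refine ⟨⟨max N N', fun x i hi => ?_⟩, fun i => (diffOps S).sub_mem (h.mem i) (h'.mem i)⟩
  rw [PsiDO.coeff_sub, hN x i (by omega), hN' x i (by omega), sub_zero]

theorem pos (h : IsLocalFamily S Φ) : IsLocalFamily S fun x => (Φ x).pos := by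
  obtain ⟨N, hN⟩ := h.bound
  refine ⟨⟨N, fun x i hi => ?_⟩, fun i => ?_⟩
  · rw [PsiDO.coeff_pos, hN x i hi, ite_self]
  · simp only [PsiDO.coeff_pos]
    split_ifs
    exacts [h.mem i, (diffOps S).zero_mem]

/-- The order bound is uniform in the parameter, so one finite box of indices serves all `x` and
each coefficient is a fixed finite sum of differential operators. -/
theorem mul_left (hS : ∀ x ∈ S, dx A x ∈ S) {P : PsiDO (DPoly m n A)} (hP : P.CoeffMem S)
    (h : IsLocalFamily S Φ) : IsLocalFamily S fun x => P * Φ x := by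
  obtain ⟨N, hN⟩ := h.bound
  obtain ⟨M, hM⟩ := P.exists_bound
  refine ⟨⟨M + N, fun x => PsiDO.coeff_mul_of_order_le hM (hN x)⟩, fun l => ?_⟩
  have hc : (fun x => (P * Φ x).coeff l) = ∑ p ∈ PsiDO.box M N l, fun x =>
      Ring.choose p.1 p.2 • (P.coeff p.1 * (dx A)^[p.2] ((Φ x).coeff (l + p.2 - p.1))) := by
    funext x
    rw [Finset.sum_apply]
    exact PsiDO.coeff_mul_eq_sum (dxR m n A) hM (hN x) l
  rw [hc]
  exact (diffOps S).sum_mem fun p _ => zsmul_mem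
    (mul_mem_diffOps (hP _) (iterate_dx_comp_mem_diffOps hS _ (h.mem _))) _

theorem mul_right (hS : ∀ x ∈ S, dx A x ∈ S) {P : PsiDO (DPoly m n A)} (hP : P.CoeffMem S)
    (h : IsLocalFamily S Φ) : IsLocalFamily S fun x => Φ x * P := by
  obtain ⟨N, hN⟩ := h.bound
  obtain ⟨M, hM⟩ := P.exists_bound
  refine ⟨⟨N + M, fun x => PsiDO.coeff_mul_of_order_le (hN x) hM⟩, fun l => ?_⟩
  have hc : (fun x => (Φ x * P).coeff l) = ∑ p ∈ PsiDO.box N M l, fun x =>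
      Ring.choose p.1 p.2 • ((dx A)^[p.2] (P.coeff (l + p.2 - p.1)) * (Φ x).coeff p.1) := by
    funext x
    rw [Finset.sum_apply]
    refine (PsiDO.coeff_mul_eq_sum (dxR m n A) (hN x) hM l).trans
      (Finset.sum_congr rfl fun p _ => ?_)
    rw [mul_comm]
    rfl
  rw [hc]
  exact (diffOps S).sum_mem fun p _ => zsmul_mem
    (mul_mem_diffOps (PsiDO.CoeffMem.iterate_dx_mem hS _ (hP _)) (h.mem _)) _

theorem single_zero : IsLocalFamily S fun x : DPoly m n A => PsiDO.single 0 x := by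
  refine ⟨⟨0, fun x i hi => by rw [PsiDO.coeff_single, if_neg (by omega)]⟩, fun i => ?_⟩
  simp only [PsiDO.coeff_single]
  split_ifs
  exacts [Submodule.subset_span ⟨0, rfl⟩, (diffOps S).zero_mem]

theorem adlerMap (hS : ∀ x ∈ S, dx A x ∈ S) {L : PsiDO (DPoly m n A)} (hL : L.CoeffMem S)
    (h : IsLocalFamily S Φ) : IsLocalFamily S fun x => adlerMap π₊ L (Φ x) :=
  (mul_right hS hL (pos (mul_left hS hL h))).sub (mul_left hS hL (pos (mul_right hS hL h)))

theorem splitMap (hS : ∀ x ∈ S, dx A x ∈ S) {L : PsiDO (DPoly m n A)} (hL : L.CoeffMem S)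
    (h : IsLocalFamily S Φ) : IsLocalFamily S fun x => splitMap π₊ L (Φ x) := by
  simp only [splitMap_eq PsiDO.isSplitting]
  exact (((mul_left hS hL (pos h)).sub (mul_right hS hL (pos h))).sub
    (pos (mul_left hS hL h))).add (pos (mul_right hS hL h))

end IsLocalFamily

/-- The operator P_ij is x ↦ the i-th coefficient of H(∂^{−j−1}x); linearity of `H` and the residue
pairing assemble these into the bracket. -/
theorem isLocalBracket_of (hS : IsAdmissible tr e S)
    (H : PsiDO (DPoly m n A) →ₗ[ℝ] PsiDO (DPoly m n A))
    (hH : ∀ Φ, IsLocalFamily S Φ → IsLocalFamily S fun x => H (Φ x)) :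
    IsLocalBracket tr e S (bracket tr e fun X => H X.toPsiDO) := by
  have hloc : ∀ i j : Idx m, ∃ p : ℕ →₀ DPoly m n A, (∀ k, p k ∈ S) ∧ ∀ x,
      (H (PsiDO.single (-j.1 - 1) 1 * PsiDO.single 0 x)).coeff i.1 =
        p.sum fun k a => a * (dx A)^[k] x := fun i j =>
    exists_coeff_of_mem_diffOps ((hH _ (.mul_left hS.dx_mem
      (.single (-j.1 - 1) S.one_mem) .single_zero)).mem i.1)
  choose p hp hp' using hloc
  refine ⟨p, hp, fun F _ G _ => ?_⟩
  have h : ∀ (X Y : OneForm m n A), trIntRes tr (H X.toPsiDO * Y.toPsiDO) =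
      X.sum fun j x => Y.sum fun i y =>
        integral (mapCoeff tr.form (((p i j).sum fun k a => a * (dx A)^[k] x) * y)) :=
    fun X Y => by
      rw [trIntRes_mul_toPsiDO, OneForm.toPsiDO_eq_sum, Finsupp.sum, Finsupp.sum, Finsupp.sum,
        map_sum]
      simp only [PsiDO.coeff_sum, Finset.sum_mul, map_sum, hp']
      rw [Finset.sum_comm]
      rfl
  exact h _ _

theorem adler_eq (z : ℝ) (X : OneForm m n A) :
    adler e z X = adlerMap π₊ (lax m e - z • 1) X.toPsiDO := rfl

theorem adler_eq_add (z : ℝ) (X : OneForm m n A) :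
    adler e z X = hamZero e X + z • hamInf e X := by
  rw [adler_eq, adlerMap_sub PsiDO.isSplitting]
  · rw [smul_one_mul]
    rfl
  · intro a
    rw [smul_one_mul, mul_smul_one]
  · intro a
    rw [smul_one_mul, smul_one_mul, PsiDO.posHom_apply, PsiDO.pos_smul]
    rfl

theorem isHamiltonianMap_adler (hS : IsAdmissible tr e S) (z : ℝ) :
    IsHamiltonianMap tr e S (adler e z) := by
  refine isHamiltonianMap_adlerMap hS (lax m e - z • 1) (fun i hi => ?_)
    (.sub hS.lax_mem (.smul z .one)) (fun D => ?_)
  · rw [PsiDO.coeff_sub, PsiDO.coeff_smul, PsiDO.one_eq, PsiDO.coeff_single, if_neg (by omega),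
      coeff_lax_of_lt i hi, smul_zero, sub_zero]
  · rw [map_sub, map_smul, PsiDO.lie_one, smul_zero, sub_zero]

theorem isPoissonBracket_pencil (hS : IsAdmissible tr e S)
    (hInf : IsHamiltonianMap tr e S (hamInf e)) (a b : ℝ) :
    IsPoissonBracket tr S fun f g =>
      a • bracket tr e (hamZero e) f g + b • bracket tr e (hamInf e) f g := by
  by_cases ha : a = 0
  · simp only [ha, zero_smul, zero_add]
    exact (hInf.isPoissonBracket hS).smul b
  · have h := ((isHamiltonianMap_adler hS (b / a)).isPoissonBracket hS).smul a
    -- For a ≠ 0 the combination is a times the bracket of A^{(b/a)}.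
    convert h using 3 with f g
    have h1 : bracket tr e (adler e (b / a)) f g =
        bracket tr e (hamZero e) f g + (b / a) • bracket tr e (hamInf e) f g := by
      change trIntResHom tr (adler e (b / a) (varDerivL tr e f) * _) =
        trIntResHom tr (hamZero e (varDerivL tr e f) * _)
          + (b / a) • trIntResHom tr (hamInf e (varDerivL tr e f) * _)
      rw [adler_eq_add, add_mul, map_add, smul_mul_assoc, map_smul]
    rw [h1, smul_add, smul_smul, mul_div_cancel₀ _ ha]

end Poly

end FrobKP
open FrobKP in
theorem lemma3p4 {A : Type*} [CommRing A] [Algebra ℝ A] (tr : TraceForm A)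
    {n : ℕ} (e : Module.Basis (Fin n) ℝ A) {m : ℕ} (hm : 0 < m)
    (S : Subalgebra A (DPoly m n A)) (hS : S = ⊤ ∨ S = diffPolyV m e) :
    (∀ z : ℝ, IsHamiltonianMap tr e S (adler e z)) ∧
    (∀ (z : ℝ), ∀ X ∈ Omega S, adler e z X = hamZero e X + z • hamInf e X) ∧
    IsHamiltonianMap tr e S (hamZero e) ∧
    IsHamiltonianMap tr e S (hamInf e) ∧
    (∀ F ∈ S, varDerivL tr e (mapCoeff tr.form F) ∈ Omega S) ∧
    IsPoissonBracket tr S (bracket tr e (hamZero e)) ∧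
    IsLocalBracket tr e S (bracket tr e (hamZero e)) ∧
    IsPoissonBracket tr S (bracket tr e (hamInf e)) ∧
    IsLocalBracket tr e S (bracket tr e (hamInf e)) ∧
    ∀ a b : ℝ, IsPoissonBracket tr S fun f g =>
      a • bracket tr e (hamZero e) f g + b • bracket tr e (hamInf e) f g := by
  have hS : IsAdmissible tr e S := by
    rcases hS with rfl | rfl
    exacts [isAdmissible_top tr e, isAdmissible_diffPolyV tr e]
  have h0 : IsHamiltonianMap tr e S (hamZero e) :=
    isHamiltonianMap_adlerMap hS (lax m e) coeff_lax_of_lt hS.lax_mem fun _ => rfl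
  have hInf : IsHamiltonianMap tr e S (hamInf e) := isHamiltonianMap_splitMap hm hS
  exact ⟨isHamiltonianMap_adler hS, fun z X _ => adler_eq_add z X, h0, hInf,
    fun F hF => hS.varDerivL_mem hF, h0.isPoissonBracket hS,
    isLocalBracket_of hS (adlerLin (lax m e)) fun Φ h => h.adlerMap hS.dx_mem hS.lax_mem,
    hInf.isPoissonBracket hS,
    isLocalBracket_of hS (splitLin (lax m e)) fun Φ h => h.splitMap hS.dx_mem hS.lax_mem,
    isPoissonBracket_pencil hS hInf⟩
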